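/- Let $n\ge 2$, let $(N^{n-1},\bar g)$ be a connected smooth Riemannian manifold, let $\varphi:\mathbb R\to(0,\infty)$ be smooth, and let $M^n=\mathbb R\times_\varphi N$, i.e. $M=\mathbb R\times N$ with the warped product metric $g=dr^2+\varphi(r)^2\bar g$. Suppose that $(M,g)$ is complete and that it is a non-trivial gradient steady Yamabe soliton, i.e. there is a non-constant smooth function $f:M\to\mathbb R$ with $$\operatorname{Hess} f = R\,g,$$ where $R$ is the scalar curvature of $(M,g)$. Then $\varphi\equiv c$ for a constant $c>0$, so that $(M,g)$ is the Riemannian product of $(\mathbb R,dr^2)$ and $(N,c^2\bar g)$, and $(N,\bar g)$ has zero scalar curvature. In particular, there is no such soliton when $(N,\bar g)$ has positive constant scalar curvature. -/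

import Mathlib

set_option maxSynthPendingDepth 3

open scoped Manifold ContDiff Topology ENNReal

noncomputable section

namespace YamabeSoliton

/-! ### Riemannian geometry in coordinates

`E` is the coordinate space, and `G y` is the bilinear form of the metric at the coordinate
point `y`. All formulas are basis-free versions of the usual index formulas. -/

section Coordinates

variable {E : Type*} [NormedAddCommGroup E] [NormedSpace ℝ E]

/-- Christoffel symbols of the first kind,
`(u, v, z) ↦ 1/2 * (∂_u G (v, z) + ∂_v G (u, z) - ∂_z G (u, v))`; see `christoffelFirst_apply`. -/
def christoffelFirst (G : E → E →L[ℝ] E →L[ℝ] ℝ) (y : E) : E →L[ℝ] E →L[ℝ] E →L[ℝ] ℝ :=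
  let D : E →L[ℝ] E →L[ℝ] E →L[ℝ] ℝ := fderiv ℝ G y
  let T : (E →L[ℝ] E →L[ℝ] ℝ) →L[ℝ] (E →L[ℝ] E →L[ℝ] ℝ) :=
    (ContinuousLinearMap.flipₗᵢ ℝ E E ℝ).toContinuousLinearEquiv.toContinuousLinearMap
  (1 / 2 : ℝ) • (D + D.flip - T.comp D.flip)

theorem christoffelFirst_apply (G : E → E →L[ℝ] E →L[ℝ] ℝ) (y u v z : E) :
    christoffelFirst G y u v z =
      1 / 2 * (fderiv ℝ G y u v z + fderiv ℝ G y v u z - fderiv ℝ G y z u v) := by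
  simp [christoffelFirst]

/-- Christoffel symbols of the second kind: `Γ(u, v)` is the vector with
`G (Γ(u, v), z) = christoffelFirst (u, v, z)` for all `z`. Here `(G y).inverse` raises an index:
it is the inverse of `G y : E → E*` (which is invertible for a metric in finite dimension). -/
def christoffel (G : E → E →L[ℝ] E →L[ℝ] ℝ) (y : E) : E →L[ℝ] E →L[ℝ] E :=
  (ContinuousLinearMap.compL ℝ E (E →L[ℝ] ℝ) E (G y).inverse).comp (christoffelFirst G y)

theorem christoffel_apply (G : E → E →L[ℝ] E →L[ℝ] ℝ) (y u v : E) :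
    christoffel G y u v = (G y).inverse (christoffelFirst G y u v) := rfl

/-- The curvature endomorphism, `R(u, v) w = ∇_u ∇_v w - ∇_v ∇_u w` for constant fields, that is
`∂_u Γ(v, w) - ∂_v Γ(u, w) + Γ(u, Γ(v, w)) - Γ(v, Γ(u, w))`. -/
def curvature (G : E → E →L[ℝ] E →L[ℝ] ℝ) (y u v w : E) : E :=
  fderiv ℝ (christoffel G) y u v w - fderiv ℝ (christoffel G) y v u w
    + christoffel G y u (christoffel G y v w) - christoffel G y v (christoffel G y u w)

/-- The linear map `u ↦ R(u, v) w`. -/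
def curvatureMap (G : E → E →L[ℝ] E →L[ℝ] ℝ) (y v w : E) : E →ₗ[ℝ] E where
  toFun u := curvature G y u v w
  map_add' a b := by simp [curvature]; abel
  map_smul' c a := by simp [curvature, smul_sub, smul_add]

/-- The Ricci curvature `Ric(v, w) = tr (u ↦ R(u, v) w)`. -/
def ricci (G : E → E →L[ℝ] E →L[ℝ] ℝ) (y : E) : E →ₗ[ℝ] E →ₗ[ℝ] ℝ :=
  LinearMap.mk₂ ℝ (fun v w => LinearMap.trace ℝ E (curvatureMap G y v w))
    (fun a b w => by
      rw [← map_add]; congr 1; ext u; simp [curvatureMap, curvature]; abel)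
    (fun c a w => by
      rw [← map_smul]; congr 1; ext u; simp [curvatureMap, curvature, smul_sub, smul_add])
    (fun v a b => by
      rw [← map_add]; congr 1; ext u; simp [curvatureMap, curvature]; abel)
    (fun c v a => by
      rw [← map_smul]; congr 1; ext u; simp [curvatureMap, curvature, smul_sub, smul_add])

/-- The scalar curvature at the coordinate point `y`: the trace of the Ricci endomorphism
`v ↦ (Ric(v, ·))♯`. -/
def localScalar [FiniteDimensional ℝ E] (G : E → E →L[ℝ] E →L[ℝ] ℝ) (y : E) : ℝ :=
  LinearMap.trace ℝ E
    (((G y).inverse : (E →L[ℝ] ℝ) →ₗ[ℝ] E) ∘ₗ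
      (LinearMap.toContinuousLinearMap : (E →ₗ[ℝ] ℝ) ≃ₗ[ℝ] (E →L[ℝ] ℝ)).toLinearMap ∘ₗ ricci G y)

/-- The Hessian of `F` at the coordinate point `y`, `∂_u ∂_v F - dF (Γ(u, v))`. -/
def localHessian (G : E → E →L[ℝ] E →L[ℝ] ℝ) (F : E → ℝ) (y u v : E) : ℝ :=
  fderiv ℝ (fderiv ℝ F) y u v - fderiv ℝ F y (christoffel G y u v)

end Coordinates

/-! ### Riemannian geometry on a manifold without boundary -/

section Manifold

variable {E : Type*} [NormedAddCommGroup E] [NormedSpace ℝ E] [FiniteDimensional ℝ E]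
  {H : Type*} [TopologicalSpace H]

/-- Smooth Riemannian metrics on `M`. -/
abbrev Metric (I : ModelWithCorners ℝ E H) (M : Type*) [TopologicalSpace M]
    [ChartedSpace H M] [IsManifold I ∞ M] :=
  Bundle.ContMDiffRiemannianMetric I ∞ E (fun x : M => TangentSpace I x)

variable {I : ModelWithCorners ℝ E H} [I.Boundaryless]
  {M : Type*} [TopologicalSpace M] [ChartedSpace H M] [IsManifold I ∞ M]

/-- The expression of `g` in the chart at `x₀`, the pull-back of `g` by the inverse chart. -/
def metricInChart (g : Metric I M) (x₀ : M) (y : E) : E →L[ℝ] E →L[ℝ] ℝ :=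
  let B : E →L[ℝ] E →L[ℝ] ℝ := g.inner ((extChartAt I x₀).symm y)
  let A : E →L[ℝ] E := mfderiv 𝓘(ℝ, E) I (extChartAt I x₀).symm y
  B.bilinearComp A A

/-- The scalar curvature of `g` at `x`, computed in the chart at `x`. -/
def scalarCurvature (g : Metric I M) (x : M) : ℝ :=
  localScalar (metricInChart g x) (extChartAt I x x)

/-- The Hessian of `f` at `x` with respect to `g`, computed in the chart at `x`. -/
def hessian (g : Metric I M) (f : M → ℝ) (x : M) (u v : TangentSpace I x) : ℝ :=
  localHessian (metricInChart g x) (f ∘ (extChartAt I x).symm) (extChartAt I x x)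
    (mfderiv I 𝓘(ℝ, E) (extChartAt I x) x u) (mfderiv I 𝓘(ℝ, E) (extChartAt I x) x v)

open scoped Bundle in
/-- The Riemannian distance of `g`, the infimum of the lengths of `C^1` paths. -/
def riemannianDistance (g : Metric I M) (x y : M) : ℝ≥0∞ :=
  letI : Bundle.RiemannianBundle (fun x : M => TangentSpace I x) := ⟨g.toRiemannianMetric⟩
  Manifold.riemannianEDist I x y

/-- `(M, g)` is complete: every Cauchy sequence for the Riemannian distance converges. -/
def IsCompleteMetric (g : Metric I M) : Prop :=
  ∀ s : ℕ → M,
    (∀ ε : ℝ≥0∞, 0 < ε → ∃ k : ℕ, ∀ i ≥ k, ∀ j ≥ k, riemannianDistance g (s i) (s j) < ε) →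
    ∃ x : M, Filter.Tendsto (fun i => riemannianDistance g (s i) x) Filter.atTop (𝓝 0)

/-- `(M, g, f)` is a complete gradient Yamabe soliton with constant `ρ`: `g` is complete, `f` is
smooth, and `Hess f = (R - ρ) g`. -/
structure IsCompleteGradientYamabeSoliton (g : Metric I M) (f : M → ℝ) (ρ : ℝ) : Prop where
  complete : IsCompleteMetric g
  smooth : ContMDiff I 𝓘(ℝ, ℝ) ∞ f
  hess_eq : ∀ (x : M) (u v : TangentSpace I x),
    hessian g f x u v = (scalarCurvature g x - ρ) * g.inner x u v

variable {N : Type*} [TopologicalSpace N] [ChartedSpace H N] [IsManifold I ∞ N]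

/-- `g` is the warped product metric `dr² + φ(r)² h` on `ℝ × N`. -/
def IsWarpedProduct (g : Metric (𝓘(ℝ, ℝ).prod I) (ℝ × N)) (φ : ℝ → ℝ) (h : Metric I N) : Prop :=
  ∀ (x : ℝ × N) (u v : TangentSpace (𝓘(ℝ, ℝ).prod I) x),
    let dr : TangentSpace (𝓘(ℝ, ℝ).prod I) x → ℝ :=
      fun w => mfderiv (𝓘(ℝ, ℝ).prod I) 𝓘(ℝ, ℝ) Prod.fst x w
    g.inner x u v = dr u * dr v +
      φ x.1 ^ 2 * h.inner x.2 (mfderiv (𝓘(ℝ, ℝ).prod I) I Prod.snd x u)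
        (mfderiv (𝓘(ℝ, ℝ).prod I) I Prod.snd x v)

/-- `g` is the Riemannian product metric `dr² + h` on `ℝ × N`. -/
def IsRiemannianProduct (g : Metric (𝓘(ℝ, ℝ).prod I) (ℝ × N)) (h : Metric I N) : Prop :=
  IsWarpedProduct g (fun _ => 1) h

end Manifold

end YamabeSoliton

end

/-!
Let `M = ℝ × N` carry the warped product metric `dr² + φ(r)² h`, with `Hess f = R g`.

The mixed components of the equation say that the derivative of `f` along `N` is proportional to
`φ(r)`. As `N` is connected, `f = φ(r) w(p) + u(r)` (`exists_separated`). The scalar curvature of the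
warped product (`IsWarpedOn.localScalar_eq`) then turns the equation into two identities
(`separated_equations`), in which `d` is the dimension and `S` the scalar curvature of `N`:

* `φ'' w + u'' = S / φ² - 2 d φ'' / φ - d (d - 1) (φ' / φ)²`,
* `Hess w = ((φ φ'' - φ'²) w + φ u'' - φ' u') h`.

If `w` is constant, `f` depends on `r` only, `f' = c φ` with `c ≠ 0`, and `φ` is a positive solution
on the whole line of `c φ' φ² = S - 2 d φ φ'' - d (d - 1) φ'²`. Such solutions are constant
(`IsWarpingSolution.deriv_eq_zero_of_ne`): the others reach zero or blow up in finite time. After a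
reflection `c > 0`. For `S ≥ 0` a solution that decreases somewhere, followed backwards, eventually
satisfies an inequality `φ' ≥ ε φ²` in reversed time; in all other cases the sign of `φ''` leads to
a contradiction with `φ > 0` or with the sign of `φ'`. A constant `φ` forces `S = 0`.

If `w` takes two values, comparing the identities at two points of `N` shows that `φ'' φ²` and
`φ φ'' - φ'²` are constant, and this already makes `φ` constant. Then `u''` is a constant,
`S = φ² u''` and `Hess w = φ u'' h`. The gradient of `w` is thus a homothetic field, along which the
scalar curvature scales at the rate `-2 φ u''` (`IsConicField.fderiv_localScalar_field`, from the
second Bianchi identity and the pair symmetry of the curvature). As `S` is constant, `φ u'' S = 0`,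
hence `u'' = 0` and `S = 0`.

The definitions use the chart at each point, so the differentiated identities need the scalar
curvature and the Hessian at all points of one chart; this is the invariance under changes of
coordinates, `localScalar_metricInChart` and `localHessian_metricInChart`.
-/

noncomputable section

namespace YamabeSoliton

/-! ### The Levi-Civita connection in coordinates -/

section Connection

variable {E : Type*} [NormedAddCommGroup E] [NormedSpace ℝ E]
  {F K L : Type*} [NormedAddCommGroup F] [NormedSpace ℝ F] [NormedAddCommGroup K] [NormedSpace ℝ K]
  [NormedAddCommGroup L] [NormedSpace ℝ L]

theorem fderiv_clm_apply_apply {c : E → F →L[ℝ] K} {a : E → F} {y : E}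
    (hc : DifferentiableAt ℝ c y) (ha : DifferentiableAt ℝ a y) (z : E) :
    fderiv ℝ (fun x => c x (a x)) y z = fderiv ℝ c y z (a y) + c y (fderiv ℝ a y z) := by
  rw [fderiv_clm_apply hc ha]; simp [add_comm]

theorem fderiv_clm_apply₂_apply {c : E → F →L[ℝ] K →L[ℝ] L} {a : E → F} {b : E → K} {y : E}
    (hc : DifferentiableAt ℝ c y) (ha : DifferentiableAt ℝ a y) (hb : DifferentiableAt ℝ b y)
    (z : E) :
    fderiv ℝ (fun x => c x (a x) (b x)) y z =
      fderiv ℝ c y z (a y) (b y) + c y (fderiv ℝ a y z) (b y) + c y (a y) (fderiv ℝ b y z) := by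
  rw [fderiv_clm_apply_apply (hc.clm_apply ha) hb, fderiv_clm_apply_apply hc ha]
  simp

/-- `G` is a smooth Riemannian metric on the open set `U` of the coordinate space. Nothing is asked
of the values of `G` outside `U`. -/
structure IsMetricOn (G : E → E →L[ℝ] E →L[ℝ] ℝ) (U : Set E) : Prop where
  isOpen : IsOpen U
  contDiffAt : ∀ y ∈ U, ContDiffAt ℝ ∞ G y
  symm : ∀ y ∈ U, ∀ u v, G y u v = G y v u
  pos : ∀ y ∈ U, ∀ u, u ≠ 0 → 0 < G y u u

theorem _root_.ContDiffAt.fderiv_infty {f : E → F} {y : E} (hf : ContDiffAt ℝ ∞ f y) :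
    ContDiffAt ℝ ∞ (fderiv ℝ f) y :=
  hf.fderiv_right (m := ∞) le_rfl

theorem _root_.ContDiffAt.differentiableAt_infty {f : E → F} {y : E} (hf : ContDiffAt ℝ ∞ f y) :
    DifferentiableAt ℝ f y :=
  hf.differentiableAt (by simp)

theorem _root_.ContDiffAt.fderiv_fderiv_comm {f : E → F} {y : E} (hf : ContDiffAt ℝ ∞ f y)
    (u v : E) : fderiv ℝ (fderiv ℝ f) y u v = fderiv ℝ (fderiv ℝ f) y v u :=
  hf.isSymmSndFDerivAt (by simpa using WithTop.coe_le_coe.2 (le_top (a := (2 : ℕ∞)))) u v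

namespace IsMetricOn

variable {G : E → E →L[ℝ] E →L[ℝ] ℝ} {U : Set E} (hG : IsMetricOn G U) {y : E} (hy : y ∈ U)

include hG hy

theorem mem_nhds : U ∈ 𝓝 y := hG.isOpen.mem_nhds hy

theorem differentiableAt : DifferentiableAt ℝ G y := (hG.contDiffAt y hy).differentiableAt_infty

theorem ext_inner {u v : E} (h : ∀ z, G y u z = G y v z) : u = v := by
  by_contra hne
  have := hG.pos y hy (u - v) (sub_ne_zero.2 hne)
  simp [h] at this

theorem fderiv_symm (z u v : E) : fderiv ℝ G y z u v = fderiv ℝ G y z v u := by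
  have h1 := fderiv_clm_apply₂_apply (hG.differentiableAt hy) (differentiableAt_const u)
    (differentiableAt_const v) z
  have h2 := fderiv_clm_apply₂_apply (hG.differentiableAt hy) (differentiableAt_const v)
    (differentiableAt_const u) z
  have h3 : (fun x => G x u v) =ᶠ[𝓝 y] fun x => G x v u :=
    Filter.eventually_of_mem (hG.mem_nhds hy) fun x hx => hG.symm x hx u v
  rw [h3.fderiv_eq] at h1
  simp at h1 h2
  rw [← h1, h2]

variable [FiniteDimensional ℝ E]

theorem isInvertible : (G y).IsInvertible := by
  have hinj : Function.Injective ((G y : E →ₗ[ℝ] E →L[ℝ] ℝ)) := by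
    intro u v huv
    exact hG.ext_inner hy fun z => congrArg (fun ℓ : E →L[ℝ] ℝ => ℓ z) huv
  have hdim : Module.finrank ℝ E = Module.finrank ℝ (E →L[ℝ] ℝ) := by
    rw [← LinearEquiv.finrank_eq (LinearMap.toContinuousLinearMap : (E →ₗ[ℝ] ℝ) ≃ₗ[ℝ] _)]
    exact (Subspace.dual_finrank_eq (K := ℝ) (V := E)).symm
  refine ⟨(LinearEquiv.ofInjectiveOfFinrankEq _ hinj hdim).toContinuousLinearEquiv, ?_⟩
  ext u v
  rfl

theorem inverse_apply (ℓ : E →L[ℝ] ℝ) (z : E) : G y ((G y).inverse ℓ) z = ℓ z := by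
  obtain ⟨e, he⟩ := hG.isInvertible hy
  rw [← he, ContinuousLinearMap.inverse_equiv]
  simp

theorem contDiffAt_inverse : ContDiffAt ℝ ∞ (fun x => (G x).inverse) y :=
  have : CompleteSpace E := FiniteDimensional.complete ℝ E
  ContDiffAt.comp y (hG.isInvertible hy).contDiffAt_map_inverse (hG.contDiffAt y hy)

/-- The defining property of the Levi-Civita connection (the Koszul formula). -/
theorem christoffel_inner (u v z : E) :
    G y (christoffel G y u v) z =
      1 / 2 * (fderiv ℝ G y u v z + fderiv ℝ G y v u z - fderiv ℝ G y z u v) := by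
  rw [christoffel_apply, hG.inverse_apply hy, christoffelFirst_apply]

theorem christoffel_eq {u v w : E}
    (h : ∀ z, G y w z = 1 / 2 * (fderiv ℝ G y u v z + fderiv ℝ G y v u z - fderiv ℝ G y z u v)) :
    christoffel G y u v = w :=
  hG.ext_inner hy fun z => by rw [h, hG.christoffel_inner hy]

/-- The connection is torsion-free. -/
theorem christoffel_symm (u v : E) : christoffel G y u v = christoffel G y v u :=
  hG.christoffel_eq hy fun z => by
    rw [hG.christoffel_inner hy, hG.fderiv_symm hy z u v]; ring

/-- The connection is metric. -/
theorem fderiv_eq (z u v : E) :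
    fderiv ℝ G y z u v = G y (christoffel G y z u) v + G y u (christoffel G y z v) := by
  rw [hG.symm y hy u, hG.christoffel_inner hy, hG.christoffel_inner hy, hG.fderiv_symm hy z v u,
    hG.fderiv_symm hy u z v, hG.fderiv_symm hy v z u]
  ring

theorem contDiffAt_christoffel : ContDiffAt ℝ ∞ (christoffel G) y := by
  have h1 : ContDiffAt ℝ ∞ (christoffelFirst G) y := by
    have hD := (hG.contDiffAt y hy).fderiv_infty
    have hF : ContDiffAt ℝ ∞ (fun x => (fderiv ℝ G x).flip) y :=
      (ContinuousLinearMap.flipₗᵢ ℝ E E (E →L[ℝ] ℝ)).toContinuousLinearEquiv.contDiff.contDiffAt.comp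
        y hD
    exact ((hD.add hF).sub (contDiffAt_const.clm_comp hF)).const_smul _
  exact ((ContinuousLinearMap.compL ℝ E (E →L[ℝ] ℝ) E).contDiff.contDiffAt.comp y
    (hG.contDiffAt_inverse hy)).clm_comp h1

theorem differentiableAt_christoffel : DifferentiableAt ℝ (christoffel G) y :=
  (hG.contDiffAt_christoffel hy).differentiableAt_infty

theorem fderiv_christoffel_symm (z u v : E) :
    fderiv ℝ (christoffel G) y z u v = fderiv ℝ (christoffel G) y z v u := by
  have h1 := fderiv_clm_apply₂_apply (hG.differentiableAt_christoffel hy)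
    (differentiableAt_const u) (differentiableAt_const v) z
  have h2 := fderiv_clm_apply₂_apply (hG.differentiableAt_christoffel hy)
    (differentiableAt_const v) (differentiableAt_const u) z
  have h3 : (fun x => christoffel G x u v) =ᶠ[𝓝 y] fun x => christoffel G x v u :=
    Filter.eventually_of_mem (hG.mem_nhds hy) fun x hx => hG.christoffel_symm hx u v
  rw [h3.fderiv_eq] at h1
  simp at h1 h2
  rw [← h1, h2]

end IsMetricOn

end Connection

/-! ### Ricci and scalar curvature as traces -/

section Traces

variable {E : Type*} [NormedAddCommGroup E] [NormedSpace ℝ E] [FiniteDimensional ℝ E]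
  {G : E → E →L[ℝ] E →L[ℝ] ℝ} {U : Set E} {y : E}

omit [FiniteDimensional ℝ E] in
theorem ricci_apply (v w : E) :
    ricci G y v w = LinearMap.trace ℝ E (curvatureMap G y v w) := rfl

/-- The Ricci endomorphism, the Ricci form with an index raised. -/
def ricciEnd (G : E → E →L[ℝ] E →L[ℝ] ℝ) (y : E) : E →ₗ[ℝ] E :=
  ((G y).inverse : (E →L[ℝ] ℝ) →ₗ[ℝ] E) ∘ₗ
    (LinearMap.toContinuousLinearMap : (E →ₗ[ℝ] ℝ) ≃ₗ[ℝ] (E →L[ℝ] ℝ)).toLinearMap ∘ₗ ricci G y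

theorem localScalar_eq_trace : localScalar G y = LinearMap.trace ℝ E (ricciEnd G y) := rfl

theorem IsMetricOn.ricciEnd_inner (hG : IsMetricOn G U) (hy : y ∈ U) (v w : E) :
    G y (ricciEnd G y v) w = ricci G y v w := by
  simp [ricciEnd, hG.inverse_apply hy]

theorem IsMetricOn.ricciEnd_eq (hG : IsMetricOn G U) (hy : y ∈ U) {Q : E →ₗ[ℝ] E}
    (hQ : ∀ v w, G y (Q v) w = ricci G y v w) : ricciEnd G y = Q :=
  LinearMap.ext fun v => hG.ext_inner hy fun w => by rw [hG.ricciEnd_inner hy, hQ]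

end Traces

/-! ### Invariance under changes of coordinates -/

section Pullback

variable {E : Type*} [NormedAddCommGroup E] [NormedSpace ℝ E]

/-- On `U'` the metric `G'` is the pull-back of the metric `G` on `U` by the smooth map `ψ`. The
derivative of `ψ` is then invertible on `U'`. -/
structure IsPullbackOn (G' : E → E →L[ℝ] E →L[ℝ] ℝ) (U' : Set E) (G : E → E →L[ℝ] E →L[ℝ] ℝ)
    (U : Set E) (ψ : E → E) : Prop where
  source : IsMetricOn G' U'
  target : IsMetricOn G U
  mapsTo : Set.MapsTo ψ U' U
  contDiffAt : ∀ y ∈ U', ContDiffAt ℝ ∞ ψ y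
  eq : ∀ y ∈ U', ∀ u v, G' y u v = G (ψ y) (fderiv ℝ ψ y u) (fderiv ℝ ψ y v)

namespace IsPullbackOn

variable {G G' : E → E →L[ℝ] E →L[ℝ] ℝ} {U U' : Set E} {ψ : E → E}
  (h : IsPullbackOn G' U' G U ψ) {y : E} (hy : y ∈ U')

include h hy

theorem injective_fderiv : Function.Injective (fderiv ℝ ψ y) := by
  rw [injective_iff_map_eq_zero]
  intro u hu
  by_contra hne
  have := h.source.pos y hy u hne
  simp [h.eq y hy, hu] at this

theorem fderiv_metric (z u v : E) :
    fderiv ℝ G' y z u v =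
      fderiv ℝ G (ψ y) (fderiv ℝ ψ y z) (fderiv ℝ ψ y u) (fderiv ℝ ψ y v)
        + G (ψ y) (fderiv ℝ (fderiv ℝ ψ) y z u) (fderiv ℝ ψ y v)
        + G (ψ y) (fderiv ℝ ψ y u) (fderiv ℝ (fderiv ℝ ψ) y z v) := by
  have hψ := (h.contDiffAt y hy).differentiableAt_infty
  have hψ' := (h.contDiffAt y hy).fderiv_infty.differentiableAt_infty
  have hG := h.target.differentiableAt (h.mapsTo hy)
  have h1 := fderiv_clm_apply₂_apply (h.source.differentiableAt hy) (differentiableAt_const u)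
    (differentiableAt_const v) z
  have h2 := fderiv_clm_apply₂_apply (hG.comp y hψ) (hψ'.clm_apply (differentiableAt_const u))
    (hψ'.clm_apply (differentiableAt_const v)) z
  have h3 : (fun x => G' x u v) =ᶠ[𝓝 y]
      fun x => (G ∘ ψ) x (fderiv ℝ ψ x u) (fderiv ℝ ψ x v) :=
    Filter.eventually_of_mem (h.source.mem_nhds hy) fun x hx => h.eq x hx u v
  rw [h3.fderiv_eq, h2, fderiv_comp y hG hψ, fderiv_clm_apply_apply hψ' (differentiableAt_const u),
    fderiv_clm_apply_apply hψ' (differentiableAt_const v)] at h1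
  simpa using h1.symm

variable [FiniteDimensional ℝ E]

/-- The derivative of `ψ` as a linear equivalence. -/
def fderivEquiv : E ≃ₗ[ℝ] E :=
  LinearEquiv.ofInjectiveEndo (fderiv ℝ ψ y : E →ₗ[ℝ] E) (h.injective_fderiv hy)

theorem fderivEquiv_apply (u : E) : h.fderivEquiv hy u = fderiv ℝ ψ y u := rfl

/-- The transformation law of the Christoffel symbols. -/
theorem fderiv_christoffel (u v : E) :
    fderiv ℝ ψ y (christoffel G' y u v) =
      christoffel G (ψ y) (fderiv ℝ ψ y u) (fderiv ℝ ψ y v)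
        + fderiv ℝ (fderiv ℝ ψ) y u v := by
  obtain ⟨w, hw⟩ := (h.fderivEquiv hy).surjective
    (christoffel G (ψ y) (fderiv ℝ ψ y u) (fderiv ℝ ψ y v) + fderiv ℝ (fderiv ℝ ψ) y u v)
  rw [h.fderivEquiv_apply hy] at hw
  rw [← hw]
  congr 1
  refine h.source.christoffel_eq hy fun z => ?_
  have hs := fun a b => h.target.symm _ (h.mapsTo hy) a b
  have hc := (h.contDiffAt y hy).fderiv_fderiv_comm
  rw [h.eq y hy, hw]
  simp only [map_add, add_apply, h.fderiv_metric hy,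
    h.target.christoffel_inner (h.mapsTo hy)]
  rw [hc v u, hc z u, hc z v, hs (fderiv ℝ ψ y v), hs _ (fderiv ℝ (fderiv ℝ ψ) y v z)]
  ring

theorem fderiv_fderiv_christoffel (z u v : E) :
    fderiv ℝ (fderiv ℝ ψ) y z (christoffel G' y u v)
        + fderiv ℝ ψ y (fderiv ℝ (christoffel G') y z u v) =
      fderiv ℝ (christoffel G) (ψ y) (fderiv ℝ ψ y z) (fderiv ℝ ψ y u) (fderiv ℝ ψ y v)
        + christoffel G (ψ y) (fderiv ℝ (fderiv ℝ ψ) y z u) (fderiv ℝ ψ y v)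
        + christoffel G (ψ y) (fderiv ℝ ψ y u) (fderiv ℝ (fderiv ℝ ψ) y z v)
        + fderiv ℝ (fderiv ℝ (fderiv ℝ ψ)) y z u v := by
  have hψ := (h.contDiffAt y hy).differentiableAt_infty
  have hψ' := (h.contDiffAt y hy).fderiv_infty.differentiableAt_infty
  have hψ'' := (h.contDiffAt y hy).fderiv_infty.fderiv_infty.differentiableAt_infty
  have hΓ := h.target.differentiableAt_christoffel (h.mapsTo hy)
  have hΓ' := h.source.differentiableAt_christoffel hy
  have cu := differentiableAt_const (𝕜 := ℝ) (x := y) u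
  have cv := differentiableAt_const (𝕜 := ℝ) (x := y) v
  have h1 := fderiv_clm_apply_apply hψ' ((hΓ'.clm_apply cu).clm_apply cv) z
  have h2 := fderiv_clm_apply₂_apply (hΓ.comp y hψ) (hψ'.clm_apply cu) (hψ'.clm_apply cv) z
  have h3 := fderiv_clm_apply₂_apply hψ'' cu cv z
  have h4 : (fun x => fderiv ℝ ψ x (christoffel G' x u v)) =ᶠ[𝓝 y]
      fun x => (christoffel G ∘ ψ) x (fderiv ℝ ψ x u) (fderiv ℝ ψ x v)
        + fderiv ℝ (fderiv ℝ ψ) x u v :=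
    Filter.eventually_of_mem (h.source.mem_nhds hy) fun x hx => h.fderiv_christoffel hx u v
  have h5 := fderiv_clm_apply₂_apply hΓ' cu cv z
  rw [h4.fderiv_eq, fderiv_fun_add
    (((hΓ.comp y hψ).clm_apply (hψ'.clm_apply cu)).clm_apply (hψ'.clm_apply cv))
    ((hψ''.clm_apply cu).clm_apply cv), add_apply, h2, h3, h5,
    fderiv_comp y hΓ hψ,
    fderiv_clm_apply_apply hψ' cu, fderiv_clm_apply_apply hψ' cv] at h1
  simpa using h1.symm

theorem fderiv_curvature (u v w : E) :
    fderiv ℝ ψ y (curvature G' y u v w) =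
      curvature G (ψ y) (fderiv ℝ ψ y u) (fderiv ℝ ψ y v) (fderiv ℝ ψ y w) := by
  have h1 := h.fderiv_fderiv_christoffel hy u v w
  have h2 := h.fderiv_fderiv_christoffel hy v u w
  have hc := (h.contDiffAt y hy).fderiv_fderiv_comm
  have hc3 : fderiv ℝ (fderiv ℝ (fderiv ℝ ψ)) y u v w = fderiv ℝ (fderiv ℝ (fderiv ℝ ψ)) y v u w := by
    rw [(h.contDiffAt y hy).fderiv_infty.fderiv_fderiv_comm]
  rw [← eq_sub_iff_add_eq'] at h1 h2
  simp only [curvature, map_add, map_sub, h.fderiv_christoffel hy, h1, h2, hc v u, hc3]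
  abel

theorem ricci_eq (v w : E) :
    ricci G' y v w = ricci G (ψ y) (fderiv ℝ ψ y v) (fderiv ℝ ψ y w) := by
  have : curvatureMap G' y v w = (h.fderivEquiv hy).symm.conj
      (curvatureMap G (ψ y) (fderiv ℝ ψ y v) (fderiv ℝ ψ y w)) := by
    ext u
    apply (h.fderivEquiv hy).injective
    rw [LinearEquiv.conj_apply_apply, LinearEquiv.apply_symm_apply]
    exact h.fderiv_curvature hy u v w
  rw [ricci_apply, this, LinearMap.trace_conj', ricci_apply]

theorem localScalar_eq : localScalar G' y = localScalar G (ψ y) := by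
  have : ricciEnd G' y = (h.fderivEquiv hy).symm.conj (ricciEnd G (ψ y)) := by
    refine h.source.ricciEnd_eq hy fun v w => ?_
    rw [h.eq y hy, ← h.fderivEquiv_apply hy, LinearEquiv.conj_apply_apply,
      LinearEquiv.apply_symm_apply, h.target.ricciEnd_inner (h.mapsTo hy), h.ricci_eq hy]
    rfl
  rw [localScalar_eq_trace, this, LinearMap.trace_conj', localScalar_eq_trace]

theorem localHessian_eq {F : E → ℝ} {U : Set E} (hU : IsOpen U) (hyU : ψ y ∈ U)
    (hF : ∀ x ∈ U, ContDiffAt ℝ ∞ F x) (u v : E) :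
    localHessian G' (F ∘ ψ) y u v =
      localHessian G F (ψ y) (fderiv ℝ ψ y u) (fderiv ℝ ψ y v) := by
  have hψ := (h.contDiffAt y hy).differentiableAt_infty
  have hψ' := (h.contDiffAt y hy).fderiv_infty.differentiableAt_infty
  have hF0 := (hF _ hyU).differentiableAt_infty
  have hF1 := (hF _ hyU).fderiv_infty.differentiableAt_infty
  have cv := differentiableAt_const (𝕜 := ℝ) (x := y) v
  have hnhds : ∀ᶠ x in 𝓝 y, x ∈ U' ∧ ψ x ∈ U :=
    (Filter.eventually_of_mem (h.source.mem_nhds hy) fun _ hx => hx).and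
      (hψ.continuousAt.eventually_mem (hU.mem_nhds hyU))
  have h1 : (fun x => fderiv ℝ (F ∘ ψ) x v) =ᶠ[𝓝 y]
      fun x => (fderiv ℝ F ∘ ψ) x (fderiv ℝ ψ x v) := by
    filter_upwards [hnhds] with x hx
    rw [fderiv_comp x (hF _ hx.2).differentiableAt_infty (h.contDiffAt x hx.1).differentiableAt_infty]
    rfl
  have hFψ : ContDiffAt ℝ ∞ (F ∘ ψ) y := (hF _ hyU).comp y (h.contDiffAt y hy)
  have h2 := fderiv_clm_apply_apply hFψ.fderiv_infty.differentiableAt_infty cv u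
  rw [h1.fderiv_eq, fderiv_clm_apply_apply (hF1.comp y hψ) (hψ'.clm_apply cv),
    fderiv_comp y hF1 hψ, fderiv_clm_apply_apply hψ' cv] at h2
  simp only [fderiv_fun_const, Pi.zero_apply, zero_apply, map_zero, add_zero,
    ContinuousLinearMap.comp_apply, Function.comp_apply] at h2
  rw [localHessian, localHessian, ← h2, fderiv_comp y hF0 hψ, ContinuousLinearMap.comp_apply,
    h.fderiv_christoffel hy, map_add]
  ring

end IsPullbackOn

end Pullback

/-! ### Curvature of a warped product in coordinates -/

section Warped

theorem trace_real (f : ℝ →ₗ[ℝ] ℝ) : LinearMap.trace ℝ ℝ f = f 1 := by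
  rw [LinearMap.trace_eq_matrix_trace ℝ (Module.Basis.singleton Unit ℝ) f]
  simp [Matrix.trace, LinearMap.toMatrix_apply]

/-- The trace of an endomorphism of `ℝ × E` is the sum of the traces of its diagonal blocks. -/
theorem trace_real_prod {E : Type*} [AddCommGroup E] [Module ℝ E] [FiniteDimensional ℝ E]
    (L : ℝ × E →ₗ[ℝ] ℝ × E) :
    LinearMap.trace ℝ (ℝ × E) L = (L (1, 0)).1
      + LinearMap.trace ℝ E (LinearMap.snd ℝ ℝ E ∘ₗ L ∘ₗ LinearMap.inr ℝ ℝ E) := by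
  have h1 : L = (L ∘ₗ LinearMap.inl ℝ ℝ E) ∘ₗ LinearMap.fst ℝ ℝ E
      + (L ∘ₗ LinearMap.inr ℝ ℝ E) ∘ₗ LinearMap.snd ℝ ℝ E := by
    refine LinearMap.ext fun x => ?_
    simp [← map_add]
  conv_lhs => rw [h1]
  rw [map_add, LinearMap.trace_comp_comm' (LinearMap.fst ℝ ℝ E),
    LinearMap.trace_comp_comm' (LinearMap.snd ℝ ℝ E), trace_real]
  rfl

variable {E : Type*} [NormedAddCommGroup E] [NormedSpace ℝ E]
  {K : Type*} [NormedAddCommGroup K] [NormedSpace ℝ K]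

theorem fderiv_smul_fst_snd {p : ℝ → ℝ} {q : E → K} {x : ℝ × E}
    (hp : DifferentiableAt ℝ p x.1) (hq : DifferentiableAt ℝ q x.2) (z : ℝ × E) :
    fderiv ℝ (fun x : ℝ × E => p x.1 • q x.2) x z =
      (z.1 * deriv p x.1) • q x.2 + p x.1 • fderiv ℝ q x.2 z.2 := by
  have h1 : HasFDerivAt (fun x : ℝ × E => p x.1) _ x := hp.hasFDerivAt.comp x hasFDerivAt_fst
  have h2 : HasFDerivAt (fun x : ℝ × E => q x.2) _ x := hq.hasFDerivAt.comp x hasFDerivAt_snd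
  rw [(h1.fun_smul h2).fderiv]
  simp [add_comm]

/-- On `ℝ × U` the metric `Gw` is the warped product `ds² + φ(s)² G`. -/
structure IsWarpedOn (Gw : ℝ × E → (ℝ × E) →L[ℝ] (ℝ × E) →L[ℝ] ℝ) (φ : ℝ → ℝ)
    (G : E → E →L[ℝ] E →L[ℝ] ℝ) (U : Set E) : Prop where
  total : IsMetricOn Gw (Set.univ ×ˢ U)
  base : IsMetricOn G U
  contDiff : ContDiff ℝ ∞ φ
  pos : ∀ s, 0 < φ s
  eq : ∀ x : ℝ × E, x.2 ∈ U → ∀ a b : ℝ × E, Gw x a b = a.1 * b.1 + φ x.1 ^ 2 * G x.2 a.2 b.2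

theorem _root_.ContDiff.deriv_infty {φ : ℝ → ℝ} (hφ : ContDiff ℝ ∞ φ) : ContDiff ℝ ∞ (deriv φ) :=
  (contDiff_infty_iff_deriv.1 hφ).2

theorem _root_.ContDiff.hasDerivAt_infty {φ : ℝ → ℝ} (hφ : ContDiff ℝ ∞ φ) (s : ℝ) :
    HasDerivAt φ (deriv φ s) s :=
  (hφ.differentiable (by simp) s).hasDerivAt

namespace IsWarpedOn

variable {Gw : ℝ × E → (ℝ × E) →L[ℝ] (ℝ × E) →L[ℝ] ℝ} {φ : ℝ → ℝ} {G : E → E →L[ℝ] E →L[ℝ] ℝ}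
  {U : Set E} (h : IsWarpedOn Gw φ G U) {x : ℝ × E} (hx : x.2 ∈ U)

include h

theorem hasDerivAt (s : ℝ) : HasDerivAt φ (deriv φ s) s := h.contDiff.hasDerivAt_infty s

theorem hasDerivAt_deriv (s : ℝ) : HasDerivAt (deriv φ) (deriv (deriv φ) s) s :=
  h.contDiff.deriv_infty.hasDerivAt_infty s

include hx

theorem fderiv_metric (z a b : ℝ × E) :
    fderiv ℝ Gw x z a b = 2 * φ x.1 * deriv φ x.1 * z.1 * G x.2 a.2 b.2
      + φ x.1 ^ 2 * fderiv ℝ G x.2 z.2 a.2 b.2 := by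
  have ca := differentiableAt_const (𝕜 := ℝ) (x := x) a
  have cb := differentiableAt_const (𝕜 := ℝ) (x := x) b
  have ca2 := differentiableAt_const (𝕜 := ℝ) (x := x.2) a.2
  have cb2 := differentiableAt_const (𝕜 := ℝ) (x := x.2) b.2
  have hG := h.base.differentiableAt hx
  have h1 := fderiv_clm_apply₂_apply (h.total.differentiableAt (⟨trivial, hx⟩)) ca cb z
  have h2 : (fun x => Gw x a b) =ᶠ[𝓝 x]
      fun x => a.1 * b.1 + φ x.1 ^ 2 • G x.2 a.2 b.2 :=
    Filter.eventually_of_mem (h.total.mem_nhds (⟨trivial, hx⟩)) fun y hy => h.eq y hy.2 a b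
  have h3 := (h.hasDerivAt x.1).fun_pow 2
  rw [h2.fderiv_eq, fderiv_const_add, fderiv_smul_fst_snd (p := fun s => φ s ^ 2)
    (q := fun y => G y a.2 b.2) h3.differentiableAt ((hG.clm_apply ca2).clm_apply cb2),
    fderiv_clm_apply₂_apply hG ca2 cb2, h3.deriv] at h1
  simp at h1
  rw [← h1]
  ring

variable [FiniteDimensional ℝ E]

/-- The Christoffel symbols of a warped product. -/
theorem christoffel_eq (a b : ℝ × E) :
    christoffel Gw x a b =
      (-((φ x.1 * deriv φ x.1) • G x.2 a.2 b.2),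
        christoffel G x.2 a.2 b.2 + (deriv φ x.1 / φ x.1) • (a.1 • b.2 + b.1 • a.2)) := by
  refine h.total.christoffel_eq (⟨trivial, hx⟩) fun z => ?_
  have hφ := (h.pos x.1).ne'
  have hs := h.base.symm _ hx
  simp only [h.eq x hx, h.fderiv_metric hx, map_add, add_apply, map_smul, smul_apply,
    h.base.christoffel_inner hx, smul_eq_mul]
  field_simp
  ring

theorem fderiv_christoffel (z a b : ℝ × E) :
    fderiv ℝ (christoffel Gw) x z a b =
      (-((z.1 * (deriv φ x.1 ^ 2 + φ x.1 * deriv (deriv φ) x.1)) * G x.2 a.2 b.2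
          + φ x.1 * deriv φ x.1 * fderiv ℝ G x.2 z.2 a.2 b.2),
        fderiv ℝ (christoffel G) x.2 z.2 a.2 b.2
          + (z.1 * (deriv (deriv φ) x.1 / φ x.1 - (deriv φ x.1 / φ x.1) ^ 2)) •
              (a.1 • b.2 + b.1 • a.2)) := by
  have hφ := (h.pos x.1).ne'
  have ca := differentiableAt_const (𝕜 := ℝ) (x := x) a
  have cb := differentiableAt_const (𝕜 := ℝ) (x := x) b
  have ca2 := differentiableAt_const (𝕜 := ℝ) (x := x.2) a.2
  have cb2 := differentiableAt_const (𝕜 := ℝ) (x := x.2) b.2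
  have hG := h.base.differentiableAt hx
  have hΓ := h.base.differentiableAt_christoffel hx
  have h1 := fderiv_clm_apply₂_apply (h.total.differentiableAt_christoffel (⟨trivial, hx⟩)) ca cb z
  have h2 : (fun x => christoffel Gw x a b) =ᶠ[𝓝 x] fun x =>
      (-((φ x.1 * deriv φ x.1) • G x.2 a.2 b.2),
        christoffel G x.2 a.2 b.2 + (deriv φ x.1 / φ x.1) • (a.1 • b.2 + b.1 • a.2)) :=
    Filter.eventually_of_mem (h.total.mem_nhds (⟨trivial, hx⟩)) fun y hy =>
      h.christoffel_eq hy.2 a b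
  have h3 := (h.hasDerivAt x.1).fun_mul (h.hasDerivAt_deriv x.1)
  have h4 := (h.hasDerivAt_deriv x.1).fun_div (h.hasDerivAt x.1) hφ
  have hq1 : DifferentiableAt ℝ (fun y => G y a.2 b.2) x.2 := (hG.clm_apply ca2).clm_apply cb2
  have hq2 : DifferentiableAt ℝ (fun y => christoffel G y a.2 b.2) x.2 :=
    (hΓ.clm_apply ca2).clm_apply cb2
  have hq3 : DifferentiableAt ℝ (fun _ : E => a.1 • b.2 + b.1 • a.2) x.2 := differentiableAt_const _
  have hd1 : DifferentiableAt ℝ (fun x : ℝ × E => (φ x.1 * deriv φ x.1) • G x.2 a.2 b.2) x :=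
    (h3.differentiableAt.comp x differentiableAt_fst).smul (hq1.comp x differentiableAt_snd)
  have hd2 : DifferentiableAt ℝ (fun x : ℝ × E => (christoffel G) x.2 a.2 b.2) x :=
    hq2.comp x differentiableAt_snd
  have hd3 : DifferentiableAt ℝ
      (fun x : ℝ × E => (deriv φ x.1 / φ x.1) • (a.1 • b.2 + b.1 • a.2)) x :=
    (h4.differentiableAt.comp x differentiableAt_fst).smul (differentiableAt_const _)
  have h5 : fderiv ℝ (fun x : ℝ × E => (christoffel G) x.2 a.2 b.2) x z =
      fderiv ℝ (christoffel G) x.2 z.2 a.2 b.2 := by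
    have := fderiv_comp x hq2 (differentiableAt_snd (𝕜 := ℝ) (p := x))
    have h6 := fderiv_clm_apply₂_apply hΓ ca2 cb2 z.2
    simp at h6
    rw [← h6]
    have h7 := congrArg (fun L => L z) this
    simpa [fderiv_snd, Function.comp_def] using h7
  rw [h2.fderiv_eq, hd1.fun_neg.fderiv_prodMk (hd2.fun_add hd3), fderiv_fun_neg, fderiv_fun_add hd2 hd3,
    ContinuousLinearMap.prod_apply, neg_apply, add_apply, h5,
    fderiv_smul_fst_snd (p := fun s => φ s * deriv φ s) (q := fun y => G y a.2 b.2)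
      h3.differentiableAt hq1,
    fderiv_smul_fst_snd (p := fun s => deriv φ s / φ s) (q := fun _ : E => a.1 • b.2 + b.1 • a.2)
      h4.differentiableAt hq3, h3.deriv, h4.deriv, fderiv_clm_apply₂_apply hG ca2 cb2] at h1
  simp only [fderiv_fun_const, Pi.zero_apply, zero_apply, map_zero, add_zero, smul_zero,
    smul_eq_mul] at h1
  rw [← h1]
  congr 3
  · ring
  · field_simp

/-- The Ricci curvature of a warped product. -/
theorem ricci_eq (a b : ℝ × E) :
    ricci Gw x a b = ricci G x.2 a.2 b.2
      - Module.finrank ℝ E * (deriv (deriv φ) x.1 / φ x.1) * (a.1 * b.1)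
      - (φ x.1 * deriv (deriv φ) x.1 + (Module.finrank ℝ E - 1) * deriv φ x.1 ^ 2)
        * G x.2 a.2 b.2 := by
  have hφ := (h.pos x.1).ne'
  have hs := h.base.symm _ hx
  have hΓs := h.base.christoffel_symm hx
  have h1 : (curvatureMap Gw x a b (1, 0)).1 =
      -(φ x.1 * deriv (deriv φ) x.1) * G x.2 a.2 b.2 := by
    simp [curvatureMap, curvature, h.fderiv_christoffel hx, h.christoffel_eq hx]
    field_simp
    ring
  have h2 : LinearMap.snd ℝ ℝ E ∘ₗ curvatureMap Gw x a b ∘ₗ LinearMap.inr ℝ ℝ E =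
      curvatureMap G x.2 a.2 b.2
        - (a.1 * b.1 * (deriv (deriv φ) x.1 / φ x.1) + deriv φ x.1 ^ 2 * G x.2 a.2 b.2) •
          LinearMap.id
        + deriv φ x.1 ^ 2 • (G x.2 b.2 : E →ₗ[ℝ] ℝ).smulRight a.2 := by
    ext u
    simp [curvatureMap, curvature, h.fderiv_christoffel hx, h.christoffel_eq hx]
    rw [hΓs u a.2, hs b.2 u]
    match_scalars <;> field_simp <;> ring
  rw [ricci_apply, trace_real_prod, h1, h2, map_add, map_sub, map_smul, map_smul,
    LinearMap.trace_id, LinearMap.trace_smulRight, ricci_apply]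
  simp [hs b.2 a.2]
  ring

/-- The scalar curvature of a warped product. -/
theorem localScalar_eq :
    localScalar Gw x = localScalar G x.2 / φ x.1 ^ 2
      - 2 * Module.finrank ℝ E * (deriv (deriv φ) x.1 / φ x.1)
      - Module.finrank ℝ E * (Module.finrank ℝ E - 1) * (deriv φ x.1 / φ x.1) ^ 2 := by
  have hφ := (h.pos x.1).ne'
  set t : ℝ := φ x.1 * deriv (deriv φ) x.1 + (Module.finrank ℝ E - 1) * deriv φ x.1 ^ 2 with ht
  have h1 : ricciEnd Gw x =
      ((-(Module.finrank ℝ E * (deriv (deriv φ) x.1 / φ x.1))) • LinearMap.id).prodMap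
        ((φ x.1 ^ 2)⁻¹ • (ricciEnd G x.2 - t • LinearMap.id)) := by
    refine h.total.ricciEnd_eq (⟨trivial, hx⟩) fun v w => ?_
    rw [h.eq x hx, h.ricci_eq hx]
    simp [h.base.ricciEnd_inner hx]
    field_simp
    ring
  rw [localScalar_eq_trace, h1, LinearMap.trace_prodMap', map_smul, map_smul, map_sub, map_smul,
    LinearMap.trace_id, LinearMap.trace_id, localScalar_eq_trace, Module.finrank_self, ht]
  simp only [smul_eq_mul]
  field_simp
  ring

end IsWarpedOn

end Warped

/-! ### Symmetries of the curvature and homothetic vector fields -/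

section Symmetries

variable {E : Type*} [NormedAddCommGroup E] [NormedSpace ℝ E]

theorem curvature_antisymm (G : E → E →L[ℝ] E →L[ℝ] ℝ) (y u v w : E) :
    curvature G y u v w = -curvature G y v u w := by
  simp only [curvature]; abel

variable [FiniteDimensional ℝ E] {G : E → E →L[ℝ] E →L[ℝ] ℝ} {U : Set E}

namespace IsMetricOn

variable (hG : IsMetricOn G U) {y : E} (hy : y ∈ U)

include hG hy

theorem fderiv_fderiv_eq (x z u v : E) :
    fderiv ℝ (fderiv ℝ G) y x z u v =
      fderiv ℝ G y x (christoffel G y z u) v + G y (fderiv ℝ (christoffel G) y x z u) v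
        + (fderiv ℝ G y x u (christoffel G y z v)
          + G y u (fderiv ℝ (christoffel G) y x z v)) := by
  have hd := hG.differentiableAt hy
  have hd' := (hG.contDiffAt y hy).fderiv_infty.differentiableAt_infty
  have hΓ := hG.differentiableAt_christoffel hy
  have c (a : E) := differentiableAt_const (𝕜 := ℝ) (x := y) a
  have hΓa (a : E) : DifferentiableAt ℝ (fun p => christoffel G p z a) y :=
    (hΓ.clm_apply (c z)).clm_apply (c a)
  have h1 : (fun p => fderiv ℝ G p z u v) =ᶠ[𝓝 y]
      fun p => G p (christoffel G p z u) v + G p u (christoffel G p z v) :=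
    Filter.eventually_of_mem (hG.mem_nhds hy) fun p hp => hG.fderiv_eq hp z u v
  have h2 := fderiv_clm_apply₂_apply (hd'.clm_apply (c z)) (c u) (c v) x
  have h3 := fderiv_clm_apply_apply hd' (c z) x
  have h4 (a : E) := fderiv_clm_apply₂_apply hΓ (c z) (c a) x
  rw [h1.fderiv_eq, fderiv_fun_add ((hd.clm_apply (hΓa u)).clm_apply (c v))
    ((hd.clm_apply (c u)).clm_apply (hΓa v)), add_apply,
    fderiv_clm_apply₂_apply hd (hΓa u) (c v), fderiv_clm_apply₂_apply hd (c u) (hΓa v), h3, h4,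
    h4] at h2
  simpa using h2.symm

/-- The curvature endomorphisms are skew-adjoint, since the connection is metric. -/
theorem curvature_inner (x z u v : E) :
    G y (curvature G y x z u) v = -G y u (curvature G y x z v) := by
  have h1 := hG.fderiv_fderiv_eq hy x z u v
  have h2 := hG.fderiv_fderiv_eq hy z x u v
  rw [(hG.contDiffAt y hy).fderiv_fderiv_comm x z] at h1
  simp only [hG.fderiv_eq hy] at h1 h2
  simp only [curvature, map_add, map_sub, add_apply, sub_apply]
  linarith

/-- The first Bianchi identity. -/
theorem curvature_cyclic (u v w : E) :
    curvature G y u v w + curvature G y v w u + curvature G y w u v = 0 := by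
  have h1 := hG.christoffel_symm hy
  have h2 := hG.fderiv_christoffel_symm hy
  simp only [curvature]
  rw [h2 u w v, h2 w v u, h2 v w u, h1 w v, h1 w u, h1 v u]
  abel

/-- The pair symmetry of the curvature tensor. -/
theorem curvature_pair (u v w z : E) :
    G y (curvature G y u v w) z = G y (curvature G y w z u) v := by
  have hs := hG.symm y hy
  have hb : ∀ a b c e : E, G y (curvature G y a b c) e + G y (curvature G y b c a) e
      + G y (curvature G y c a b) e = 0 := fun a b c e => by
    simpa using congrArg (fun q => G y q e) (hG.curvature_cyclic hy a b c)
  have ha : ∀ a b c e : E, G y (curvature G y a b c) e = -G y (curvature G y b a c) e :=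
    fun a b c e => by rw [curvature_antisymm]; simp
  have hm : ∀ a b c e : E, G y (curvature G y a b c) e = -G y (curvature G y a b e) c :=
    fun a b c e => by rw [hG.curvature_inner hy, hs]
  linarith [hb u v w z, hb v w z u, hb w z u v, hb z u v w, ha u v w z, ha u w v z, ha z v w u,
    ha z w v u, ha z u w v, ha z u v w, hm u v w z, hm v w u z, hm w u v z, hm v w z u, hm w z v u,
    hm z v w u, hm w z u v, hm z u w v, hm u w z v, hm z u v w, hm u v z w, hm v z u w,
    ha v z u w, ha w u v z, ha w z u v, ha u z v w, ha v w z u]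

theorem contDiffAt_curvature (u v w : E) : ContDiffAt ℝ ∞ (fun p => curvature G p u v w) y := by
  have hA := hG.contDiffAt_christoffel hy
  have hD := hA.fderiv_infty
  have c (a : E) := contDiffAt_const (𝕜 := ℝ) (n := ∞) (x := y) (c := a)
  exact ((((hD.clm_apply (c u)).clm_apply (c v)).clm_apply (c w)).sub
    (((hD.clm_apply (c v)).clm_apply (c u)).clm_apply (c w))).add
    ((hA.clm_apply (c u)).clm_apply ((hA.clm_apply (c v)).clm_apply (c w))) |>.sub
    ((hA.clm_apply (c v)).clm_apply ((hA.clm_apply (c u)).clm_apply (c w)))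

theorem fderiv_curvature (z u v w : E) :
    fderiv ℝ (fun p => curvature G p u v w) y z =
      fderiv ℝ (fderiv ℝ (christoffel G)) y z u v w
        - fderiv ℝ (fderiv ℝ (christoffel G)) y z v u w
        + (fderiv ℝ (christoffel G) y z u (christoffel G y v w)
          + christoffel G y u (fderiv ℝ (christoffel G) y z v w))
        - (fderiv ℝ (christoffel G) y z v (christoffel G y u w)
          + christoffel G y v (fderiv ℝ (christoffel G) y z u w)) := by
  have hA := hG.differentiableAt_christoffel hy
  have hD := (hG.contDiffAt_christoffel hy).fderiv_infty.differentiableAt_infty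
  have c (a : E) := differentiableAt_const (𝕜 := ℝ) (x := y) a
  have hA2 (a b : E) : DifferentiableAt ℝ (fun p => christoffel G p a b) y :=
    (hA.clm_apply (c a)).clm_apply (c b)
  have hAA (a b e : E) : DifferentiableAt ℝ
      (fun p => christoffel G p a (christoffel G p b e)) y :=
    (hA.clm_apply (c a)).clm_apply (hA2 b e)
  have hD3 (a b e : E) : DifferentiableAt ℝ (fun p => fderiv ℝ (christoffel G) p a b e) y :=
    ((hD.clm_apply (c a)).clm_apply (c b)).clm_apply (c e)
  have e1 (a b : E) : fderiv ℝ (fun p => christoffel G p a b) y z =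
      fderiv ℝ (christoffel G) y z a b := by
    simpa using fderiv_clm_apply₂_apply hA (c a) (c b) z
  have e2 (a b e : E) : fderiv ℝ (fun p => christoffel G p a (christoffel G p b e)) y z =
      fderiv ℝ (christoffel G) y z a (christoffel G y b e)
        + christoffel G y a (fderiv ℝ (christoffel G) y z b e) := by
    simpa [e1] using fderiv_clm_apply₂_apply hA (c a) (hA2 b e) z
  have e3 (a b e : E) : fderiv ℝ (fun p => fderiv ℝ (christoffel G) p a b e) y z =
      fderiv ℝ (fderiv ℝ (christoffel G)) y z a b e := by
    have := fderiv_clm_apply₂_apply (hD.clm_apply (c a)) (c b) (c e) z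
    rw [fderiv_clm_apply_apply hD (c a)] at this
    simpa using this
  simp only [curvature]
  rw [fderiv_fun_sub (((hD3 u v w).fun_sub (hD3 v u w)).fun_add (hAA u v w)) (hAA v u w),
    fderiv_fun_add ((hD3 u v w).fun_sub (hD3 v u w)) (hAA u v w),
    fderiv_fun_sub (hD3 u v w) (hD3 v u w), sub_apply, add_apply, sub_apply, e2, e2, e3, e3]

/-- The second Bianchi identity. The terms with Christoffel symbols that act on `u`, `v` and `z`
cancel because the connection is torsion-free. -/
theorem fderiv_curvature_cyclic (z u v w : E) :
    (fderiv ℝ (fun p => curvature G p u v w) y z + christoffel G y z (curvature G y u v w)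
        - curvature G y u v (christoffel G y z w))
      + (fderiv ℝ (fun p => curvature G p v z w) y u + christoffel G y u (curvature G y v z w)
        - curvature G y v z (christoffel G y u w))
      + (fderiv ℝ (fun p => curvature G p z u w) y v + christoffel G y v (curvature G y z u w)
        - curvature G y z u (christoffel G y v w)) = 0 := by
  have hc := (hG.contDiffAt_christoffel hy).fderiv_fderiv_comm
  simp only [hG.fderiv_curvature hy]
  rw [hc v u, hc v z, hc u z]
  simp only [curvature, map_add, map_sub]
  abel

end IsMetricOn

end Symmetries

section LinearMaps

variable {E : Type*} [NormedAddCommGroup E] [NormedSpace ℝ E] [FiniteDimensional ℝ E]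
  {K : Type*} [NormedAddCommGroup K] [NormedSpace ℝ K] {U : Set E} {y : E}

theorem contDiffAt_toContinuousLinearMap {T : E → E →ₗ[ℝ] K} (hU : IsOpen U) (hy : y ∈ U)
    (hT : ∀ u, ∀ x ∈ U, ContDiffAt ℝ ∞ (fun p => T p u) x) :
    ContDiffAt ℝ ∞ (fun p => LinearMap.toContinuousLinearMap (T p)) y := by
  have : ContDiffOn ℝ ∞ (fun p => LinearMap.toContinuousLinearMap (T p)) U :=
    contDiffOn_clm_apply.2 fun u x hx => (hT u x hx).contDiffWithinAt
  exact this.contDiffAt (hU.mem_nhds hy)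

theorem fderiv_linearMap_apply {T : E → E →ₗ[ℝ] K} (hU : IsOpen U) (hy : y ∈ U)
    (hT : ∀ u, ∀ x ∈ U, ContDiffAt ℝ ∞ (fun p => T p u) x) {a : E → E}
    (ha : DifferentiableAt ℝ a y) (z : E) :
    fderiv ℝ (fun p => T p (a p)) y z =
      fderiv ℝ (fun p => T p (a y)) y z + T y (fderiv ℝ a y z) := by
  have h1 := (contDiffAt_toContinuousLinearMap hU hy hT).differentiableAt_infty
  have h2 := fderiv_clm_apply_apply h1 ha z
  have h3 := fderiv_clm_apply_apply h1 (differentiableAt_const (a y)) z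
  simp at h2 h3
  rw [h2, h3]

theorem fderiv_trace {T : E → E →ₗ[ℝ] E} (hU : IsOpen U) (hy : y ∈ U)
    (hT : ∀ u, ∀ x ∈ U, ContDiffAt ℝ ∞ (fun p => T p u) x) {z : E} {L : E →ₗ[ℝ] E}
    (hL : ∀ u, fderiv ℝ (fun p => T p u) y z = L u) :
    fderiv ℝ (fun p => LinearMap.trace ℝ E (T p)) y z = LinearMap.trace ℝ E L := by
  have h1 := contDiffAt_toContinuousLinearMap hU hy hT
  let τ : (E →L[ℝ] E) →L[ℝ] ℝ := LinearMap.toContinuousLinearMap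
    (LinearMap.trace ℝ E ∘ₗ ContinuousLinearMap.coeLM ℝ)
  have h2 : (fun p => LinearMap.trace ℝ E (T p)) =
      τ ∘ fun p => LinearMap.toContinuousLinearMap (T p) := rfl
  rw [h2, fderiv_comp y τ.differentiableAt h1.differentiableAt_infty, τ.fderiv]
  change LinearMap.trace ℝ E _ = _
  congr 1
  ext u
  have h3 := fderiv_clm_apply_apply h1.differentiableAt_infty (differentiableAt_const u) z
  simp [hL] at h3
  exact h3.symm

theorem contDiffAt_trace {T : E → E →ₗ[ℝ] E} (hU : IsOpen U) (hy : y ∈ U)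
    (hT : ∀ u, ∀ x ∈ U, ContDiffAt ℝ ∞ (fun p => T p u) x) :
    ContDiffAt ℝ ∞ (fun p => LinearMap.trace ℝ E (T p)) y :=
  (LinearMap.toContinuousLinearMap
    (LinearMap.trace ℝ E ∘ₗ ContinuousLinearMap.coeLM ℝ)).contDiff.contDiffAt.comp y
      (contDiffAt_toContinuousLinearMap hU hy hT)

end LinearMaps

section Homothety

variable {E : Type*} [NormedAddCommGroup E] [NormedSpace ℝ E] [FiniteDimensional ℝ E]

/-- `X` is a smooth vector field on `U` with `∇X = b • id`, like the radial field of a cone, for which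
`b = 1`. -/
structure IsConicField (G : E → E →L[ℝ] E →L[ℝ] ℝ) (U : Set E) (X : E → E) (b : ℝ) : Prop where
  metric : IsMetricOn G U
  contDiffAt : ∀ y ∈ U, ContDiffAt ℝ ∞ X y
  eq : ∀ y ∈ U, ∀ u, fderiv ℝ X y u = b • u - christoffel G y u (X y)

variable {G : E → E →L[ℝ] E →L[ℝ] ℝ} {U : Set E} {X : E → E} {b : ℝ}

/-- If `Hess W = b G`, the gradient of `W` is a conic field. -/
theorem IsMetricOn.isConicField (hG : IsMetricOn G U) {W : E → ℝ}
    (hW : ∀ y ∈ U, ContDiffAt ℝ ∞ W y)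
    (hess : ∀ y ∈ U, ∀ u v, localHessian G W y u v = b * G y u v) :
    IsConicField G U (fun y => (G y).inverse (fderiv ℝ W y)) b := by
  have hX : ∀ y ∈ U, ContDiffAt ℝ ∞ (fun y => (G y).inverse (fderiv ℝ W y)) y := fun y hy =>
    (hG.contDiffAt_inverse hy).clm_apply (hW y hy).fderiv_infty
  refine ⟨hG, hX, fun y hy u => hG.ext_inner hy fun v => ?_⟩
  set X : E → E := fun y => (G y).inverse (fderiv ℝ W y)
  have cv := differentiableAt_const (𝕜 := ℝ) (x := y) v
  have h1 := fderiv_clm_apply₂_apply (hG.differentiableAt hy)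
    (hX y hy).differentiableAt_infty cv u
  have h2 := fderiv_clm_apply_apply (hW y hy).fderiv_infty.differentiableAt_infty cv u
  have h3 : (fun x => G x (X x) v) =ᶠ[𝓝 y] fun x => fderiv ℝ W x v :=
    Filter.eventually_of_mem (hG.mem_nhds hy) fun x hx => hG.inverse_apply hx _ _
  have h4 := hess y hy u v
  have h5 : G y (X y) (christoffel G y u v) = fderiv ℝ W y (christoffel G y u v) :=
    hG.inverse_apply hy _ _
  rw [h3.fderiv_eq, h2, hG.fderiv_eq hy] at h1
  simp [localHessian] at h1 h4
  simp
  linarith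

namespace IsConicField

variable (h : IsConicField G U X b) {y : E} (hy : y ∈ U)

include h hy

theorem curvature_field (u v : E) : curvature G y u v (X y) = 0 := by
  have hX := (h.contDiffAt y hy).differentiableAt_infty
  have hX' := (h.contDiffAt y hy).fderiv_infty.differentiableAt_infty
  have hA := h.metric.differentiableAt_christoffel hy
  have c (a : E) := differentiableAt_const (𝕜 := ℝ) (x := y) a
  have key (x z : E) : fderiv ℝ (fderiv ℝ X) y x z =
      -(fderiv ℝ (christoffel G) y x z (X y)
        + christoffel G y z (b • x - christoffel G y x (X y))) := by
    have h1 := fderiv_clm_apply_apply hX' (c z) x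
    have h2 : (fun p => fderiv ℝ X p z) =ᶠ[𝓝 y] fun p => b • z - christoffel G p z (X p) :=
      Filter.eventually_of_mem (h.metric.mem_nhds hy) fun p hp => h.eq p hp z
    rw [h2.fderiv_eq, fderiv_fun_sub (c _) ((hA.clm_apply (c z)).clm_apply hX), sub_apply,
      fderiv_clm_apply₂_apply hA (c z) hX, h.eq y hy] at h1
    simp at h1
    rw [← h1]
    simp
  have h1 := key u v
  rw [(h.contDiffAt y hy).fderiv_fderiv_comm, key v u] at h1
  have h2 := h.metric.christoffel_symm hy u v
  simp only [map_sub, map_smul, h2] at h1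
  rw [curvature, ← sub_eq_zero.2 h1]
  abel

/-- The curvature also vanishes with the field in the first slot, by pair symmetry. -/
theorem curvature_field_left (v w : E) : curvature G y (X y) v w = 0 :=
  h.metric.ext_inner hy fun z => by
    rw [h.metric.curvature_pair hy, h.curvature_field hy]; simp

/-- The curvature is invariant under the flow of the homothetic field `X`, that is,
`L_X R = 0`. -/
theorem fderiv_curvature_field (u v w : E) :
    fderiv ℝ (fun p => curvature G p u v w) y (X y) =
      -curvature G y (fderiv ℝ X y u) v w - curvature G y u (fderiv ℝ X y v) w
        - christoffel G y (X y) (curvature G y u v w)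
        + curvature G y u v (christoffel G y (X y) w) := by
  have hX := (h.contDiffAt y hy).differentiableAt_infty
  have h0 : ∀ z u : E, fderiv ℝ (fun p => curvature G p (X y) u w) y z =
      -curvature G y (fderiv ℝ X y z) u w := by
    intro z u
    have h1 := fderiv_linearMap_apply (T := fun p => curvatureMap G p u w) h.metric.isOpen hy
      (fun a x hx => h.metric.contDiffAt_curvature hx a u w) hX z
    have h2 : (fun p => curvatureMap G p u w (X p)) =ᶠ[𝓝 y] fun _ => 0 :=
      Filter.eventually_of_mem (h.metric.mem_nhds hy) fun p hp => h.curvature_field_left hp u w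
    rw [h2.fderiv_eq] at h1
    simp at h1
    exact eq_neg_of_add_eq_zero_left h1.symm
  have h0' : ∀ z u : E, fderiv ℝ (fun p => curvature G p u (X y) w) y z =
      curvature G y (fderiv ℝ X y z) u w := by
    intro z u
    have : (fun p => curvature G p u (X y) w) = fun p => -curvature G p (X y) u w :=
      funext fun p => curvature_antisymm ..
    rw [this, fderiv_fun_neg, neg_apply, h0, neg_neg]
  have h3 := h.metric.fderiv_curvature_cyclic hy (X y) u v w
  have h4 (a c : E) : curvature G y a (X y) c = 0 := by
    rw [curvature_antisymm, h.curvature_field_left hy, neg_zero]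
  rw [h0, h0', h.curvature_field_left hy, h.curvature_field_left hy, h4, h4,
    map_zero, map_zero, sub_zero, sub_zero, add_zero, add_zero] at h3
  rw [curvature_antisymm G y u (fderiv ℝ X y v), ← sub_eq_zero, ← h3]
  abel

theorem fderiv_ricci_field (v w : E) :
    fderiv ℝ (fun p => ricci G p v w) y (X y) =
      -2 * b * ricci G y v w + ricci G y (christoffel G y (X y) v) w
        + ricci G y v (christoffel G y (X y) w) := by
  set A : E →ₗ[ℝ] E := (christoffel G y (X y) : E →ₗ[ℝ] E) with hA
  have h1 := fderiv_trace (T := fun p => curvatureMap G p v w) (y := y) (z := X y)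
    (L := (-2 * b) • curvatureMap G y v w + curvatureMap G y v w ∘ₗ A
      - A ∘ₗ curvatureMap G y v w + curvatureMap G y (A v) w + curvatureMap G y v (A w))
    h.metric.isOpen hy (fun a x hx => h.metric.contDiffAt_curvature hx a v w) (fun u => by
      have h2 := h.fderiv_curvature_field hy u v w
      rw [h.eq y hy, h.eq y hy, h.metric.christoffel_symm hy u, h.metric.christoffel_symm hy v] at h2
      refine h2.trans ?_
      simp [curvatureMap, curvature, hA]
      module)
  simp only [ricci_apply]
  rw [h1]
  have h2 := LinearMap.trace_comp_comm' A (curvatureMap G y v w)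
  simp only [map_add, map_sub, map_smul, h2, smul_eq_mul]
  simp only [hA, ContinuousLinearMap.coe_coe]
  ring

theorem contDiffAt_ricciEnd (v : E) : ContDiffAt ℝ ∞ (fun p => ricciEnd G p v) y := by
  have h1 : ∀ w, ∀ x ∈ U, ContDiffAt ℝ ∞ (fun p => ricci G p v w) x := fun w x hx =>
    contDiffAt_trace (T := fun p => curvatureMap G p v w) h.metric.isOpen hx
      fun a x hx => h.metric.contDiffAt_curvature hx a v w
  exact (h.metric.contDiffAt_inverse hy).clm_apply
    (contDiffAt_toContinuousLinearMap h.metric.isOpen hy h1)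

/-- Under the flow of `X` the metric scales by `exp (2 b t)` and hence the scalar curvature
by `exp (-2 b t)`. -/
theorem fderiv_localScalar_field :
    fderiv ℝ (localScalar G) y (X y) = -2 * b * localScalar G y := by
  set A : E →ₗ[ℝ] E := (christoffel G y (X y) : E →ₗ[ℝ] E) with hA
  have h1 := fderiv_trace (T := fun p => ricciEnd G p) (y := y) (z := X y)
    (L := (-2 * b) • ricciEnd G y + ricciEnd G y ∘ₗ A - A ∘ₗ ricciEnd G y)
    h.metric.isOpen hy (fun a x hx => h.contDiffAt_ricciEnd hx a) (fun v =>
      h.metric.ext_inner hy fun w => by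
        have cw := differentiableAt_const (𝕜 := ℝ) (x := y) w
        have h2 := fderiv_clm_apply₂_apply (h.metric.differentiableAt hy)
          (h.contDiffAt_ricciEnd hy v).differentiableAt_infty cw (X y)
        have h3 : (fun p => G p (ricciEnd G p v) w) =ᶠ[𝓝 y] fun p => ricci G p v w :=
          Filter.eventually_of_mem (h.metric.mem_nhds hy) fun p hp =>
            h.metric.ricciEnd_inner hp v w
        rw [h3.fderiv_eq, h.fderiv_ricci_field hy, h.metric.fderiv_eq hy,
          ← h.metric.ricciEnd_inner hy, ← h.metric.ricciEnd_inner hy,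
          ← h.metric.ricciEnd_inner hy] at h2
        simp at h2
        simp [hA]
        linarith)
  have h2 := LinearMap.trace_comp_comm' A (ricciEnd G y)
  refine h1.trans ?_
  simp only [map_add, map_sub, map_smul, h2, smul_eq_mul, localScalar_eq_trace]
  ring

end IsConicField

/-- A metric of constant scalar curvature `S` with a solution of `Hess W = b G` has `b S = 0`:
the gradient of `W` is homothetic, and scales the scalar curvature at the rate `-2 b`. -/
theorem IsMetricOn.mul_localScalar_eq_zero (hG : IsMetricOn G U) {W : E → ℝ} {S : ℝ}
    (hW : ∀ y ∈ U, ContDiffAt ℝ ∞ W y)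
    (hess : ∀ y ∈ U, ∀ u v, localHessian G W y u v = b * G y u v)
    (hS : ∀ y ∈ U, localScalar G y = S) (hU : U.Nonempty) : b * S = 0 := by
  obtain ⟨y, hy⟩ := hU
  have h1 := (hG.isConicField hW hess).fderiv_localScalar_field hy
  have h2 : localScalar G =ᶠ[𝓝 y] fun _ => S := Filter.eventually_of_mem (hG.mem_nhds hy) hS
  rw [h2.fderiv_eq, hS y hy] at h1
  simpa using h1

end Homothety

/-! ### The differential equation of the warping function -/

section ODE

theorem add_mul_le_of_le_hasDerivAt {f f' : ℝ → ℝ} (hf : ∀ r, HasDerivAt f (f' r) r) {m r₁ r : ℝ}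
    (hm : ∀ r, r₁ ≤ r → m ≤ f' r) (hr : r₁ ≤ r) : f r₁ + m * (r - r₁) ≤ f r := by
  rcases hr.eq_or_lt with rfl | hr
  · simp
  obtain ⟨ξ, hξ, h⟩ := exists_hasDerivAt_eq_slope f f' hr
    (fun x _ => (hf x).continuousAt.continuousWithinAt) (fun x _ => hf x)
  have h1 := hm ξ hξ.1.le
  rw [h, le_div_iff₀ (sub_pos.2 hr)] at h1
  linarith

theorem hasDerivAt_comp_neg {f f' : ℝ → ℝ} (hf : ∀ r, HasDerivAt f (f' r) r) (r : ℝ) :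
    HasDerivAt (fun s => f (-s)) (-f' (-r)) r := by
  exact ((hf (-r)).comp r (hasDerivAt_neg r)).congr_deriv (by ring)

/-- A nonnegative function on `ℝ` cannot decrease forever at a definite rate. -/
theorem false_of_hasDerivAt_le {f f' : ℝ → ℝ} (hf : ∀ r, HasDerivAt f (f' r) r)
    (h0 : ∀ r, 0 ≤ f r) {m r₁ : ℝ} (hm : 0 < m) (h : ∀ r, r₁ ≤ r → f' r ≤ -m) : False := by
  have h1 := add_mul_le_of_le_hasDerivAt (f := fun r => -f r) (f' := fun r => -f' r) (m := m)
    (r₁ := r₁) (r := r₁ + (f r₁ + 1) / m) (fun r => (hf r).neg) (fun r hr => by linarith [h r hr])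
    (by have := h0 r₁; have : 0 ≤ (f r₁ + 1) / m := by positivity
        linarith)
  rw [add_sub_cancel_left, mul_div_cancel₀ _ hm.ne'] at h1
  linarith [h0 (r₁ + (f r₁ + 1) / m)]

/-- A nonnegative function on `ℝ` cannot have increased forever at a definite rate. -/
theorem false_of_le_hasDerivAt {f f' : ℝ → ℝ} (hf : ∀ r, HasDerivAt f (f' r) r)
    (h0 : ∀ r, 0 ≤ f r) {m r₁ : ℝ} (hm : 0 < m) (h : ∀ r, r ≤ r₁ → m ≤ f' r) : False :=
  false_of_hasDerivAt_le (hasDerivAt_comp_neg hf) (fun r => h0 _) (r₁ := -r₁) hm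
    fun r hr => by linarith [h (-r) (by linarith)]

/-- A barrier argument: `f` stays above the level `m` if it increases whenever it meets it. -/
theorem le_of_barrier {f f' : ℝ → ℝ} (hf : ∀ r, HasDerivAt f (f' r) r) {m r₁ : ℝ} (h₁ : m ≤ f r₁)
    (h : ∀ r, r₁ ≤ r → f r = m → 0 < f' r) {r : ℝ} (hr : r₁ ≤ r) : m ≤ f r := by
  have := image_le_of_deriv_right_lt_deriv_boundary (f := fun r => -f r) (f' := fun r => -f' r)
    (a := r₁) (b := r) (B := fun _ => -m) (B' := fun _ => 0)
    (fun x _ => (hf x).neg.continuousAt.continuousWithinAt)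
    (fun x _ => (hf x).neg.hasDerivWithinAt) (by simpa using h₁) (fun x => hasDerivAt_const x _)
    (fun x hx hxm => by simpa using h x hx.1 (by simpa using hxm)) ⟨hr, le_rfl⟩
  simpa using this

/-- A barrier argument, backwards in time. -/
theorem le_of_barrier_left {f f' : ℝ → ℝ} (hf : ∀ r, HasDerivAt f (f' r) r) {m r₁ : ℝ}
    (h₁ : m ≤ f r₁) (h : ∀ r, r ≤ r₁ → f r = m → f' r < 0) {r : ℝ} (hr : r ≤ r₁) : m ≤ f r := by
  have := le_of_barrier (hasDerivAt_comp_neg hf) (m := m) (r₁ := -r₁) (r := -r) (by simpa using h₁)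
    (fun r hr hm => by linarith [h (-r) (by linarith) hm]) (by linarith)
  simpa using this

/-- Positive solutions on `ℝ`, with first and second derivative, of the differential equation of
the warping function, in which `d` is the dimension and `S` the scalar curvature of the fibre, and
the potential has the derivative `c φ`. -/
structure IsWarpingSolution (d c S : ℝ) (φ φ' φ'' : ℝ → ℝ) : Prop where
  one_le : 1 ≤ d
  hasDerivAt : ∀ r, HasDerivAt φ (φ' r) r
  hasDerivAt' : ∀ r, HasDerivAt φ' (φ'' r) r
  pos : ∀ r, 0 < φ r
  ode : ∀ r, 2 * d * φ r * φ'' r = S - d * (d - 1) * φ' r ^ 2 - c * φ' r * φ r ^ 2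

namespace IsWarpingSolution

variable {d c S : ℝ} {φ φ' φ'' : ℝ → ℝ}

theorem comp_neg (h : IsWarpingSolution d c S φ φ' φ'') :
    IsWarpingSolution d (-c) S (fun r => φ (-r)) (fun r => -φ' (-r)) (fun r => φ'' (-r)) where
  one_le := h.one_le
  hasDerivAt := hasDerivAt_comp_neg h.hasDerivAt
  hasDerivAt' r := (hasDerivAt_comp_neg h.hasDerivAt' r).fun_neg.congr_deriv (by simp)
  pos r := h.pos _
  ode r := by rw [h.ode]; ring

/-- Blow-up in finite time, for the equation in the direction in which the first-order term is
expanding. The substitution `P = φ ^ ((d - 1) / 2) * φ'` removes the term in `φ' ^ 2`, and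
`P - c / (d (d + 3)) * φ ^ ((d + 3) / 2)` is nondecreasing. Hence `φ' ≥ ε φ ^ 2` eventually, so that
`1 / φ` decreases to zero in finite time. -/
theorem false_of_pos (h : IsWarpingSolution d (-c) S φ φ' φ'') (hc : 0 < c) (hS : 0 ≤ S) {r₀ : ℝ}
    (h₀ : 0 < φ' r₀) : False := by
  have hd : 0 < d := by linarith [h.one_le]
  set e : ℝ := (d - 1) / 2 with he
  have he0 : 0 ≤ e := by rw [he]; linarith [h.one_le]
  have hpow : ∀ (q r : ℝ), HasDerivAt (fun r => φ r ^ q) (φ' r * q * φ r ^ (q - 1)) r := fun q r =>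
    (h.hasDerivAt r).rpow_const (Or.inl (h.pos r).ne')
  have hpp : ∀ (q r : ℝ), 0 < φ r ^ q := fun q r => Real.rpow_pos_of_pos (h.pos r) q
  have hadd : ∀ r, φ r ^ (e + 1) = φ r ^ e * φ r := fun r => Real.rpow_add_one (h.pos r).ne' e
  have hadd2 : ∀ r, φ r ^ (e + 2) = φ r ^ e * φ r ^ 2 := fun r => by
    rw [Real.rpow_add (h.pos r)]; norm_num
  have hsub : ∀ r, φ r ^ (e - 1) = φ r ^ e / φ r := fun r => Real.rpow_sub_one (h.pos r).ne' e
  have hφ'' : ∀ r, φ'' r =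
      (S - d * (d - 1) * φ' r ^ 2 + c * φ' r * φ r ^ 2) / (2 * d * φ r) := fun r => by
    rw [eq_div_iff (by have := h.pos r; positivity)]
    linarith [h.ode r]
  have hP : ∀ r, HasDerivAt (fun r => φ r ^ e * φ' r)
      (φ r ^ e * (S / (2 * d * φ r) + c * φ' r * φ r / (2 * d))) r := fun r => by
    refine ((hpow e r).fun_mul (h.hasDerivAt' r)).congr_deriv ?_
    have := (h.pos r).ne'
    rw [hsub, hφ'', he]
    field_simp
    ring
  have hP0 : ∀ r, r₀ ≤ r → φ r₀ ^ e * φ' r₀ ≤ φ r ^ e * φ' r := fun r hr =>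
    le_of_barrier hP le_rfl (fun r _ hm => by
      have h1 : 0 < φ' r := by
        have h2 : 0 < φ r ^ e * φ' r := hm ▸ mul_pos (hpp e r₀) h₀
        exact (mul_pos_iff_of_pos_left (hpp e r)).1 h2
      have := h.pos r
      have := hpp e r
      positivity) hr
  set c' : ℝ := c / (d * (d + 3)) with hc'
  have hc'0 : 0 < c' := by positivity
  have hW : ∀ r, HasDerivAt (fun r => φ r ^ e * φ' r - c' * φ r ^ (e + 2))
      (φ r ^ e * (S / (2 * d * φ r))) r := fun r => by
    refine ((hP r).fun_sub ((hpow (e + 2) r).const_mul c')).congr_deriv ?_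
    rw [show e + 2 - 1 = e + 1 by ring, hadd, hc', he]
    have := (h.pos r).ne'
    field_simp
    ring
  set W₀ : ℝ := φ r₀ ^ e * φ' r₀ - c' * φ r₀ ^ (e + 2) with hW₀
  have hW0 : ∀ r, r₀ ≤ r → W₀ ≤ φ r ^ e * φ' r - c' * φ r ^ (e + 2) := fun r hr => by
    have := add_mul_le_of_le_hasDerivAt hW (m := 0) (r₁ := r₀) (fun r _ => by
      have := h.pos r
      have := hpp e r
      positivity) hr
    rw [hW₀]
    linarith
  have hgrow : ∀ r, r₀ ≤ r → (e + 1) * (φ r₀ ^ e * φ' r₀) * (r - r₀) ≤ φ r ^ (e + 1) := fun r hr => by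
    have := add_mul_le_of_le_hasDerivAt (hpow (e + 1)) (m := (e + 1) * (φ r₀ ^ e * φ' r₀))
      (r₁ := r₀) (fun r hr => by
        rw [add_sub_cancel_right]
        calc _ ≤ (e + 1) * (φ r ^ e * φ' r) :=
              mul_le_mul_of_nonneg_left (hP0 r hr) (by linarith)
          _ = _ := by ring) hr
    linarith [hpp (e + 1) r₀]
  set k : ℝ := (e + 1) * (φ r₀ ^ e * φ' r₀) with hk
  have hk0 : 0 < k := by have := hpp e r₀; positivity
  set B : ℝ := 1 + 2 * |W₀| / c' with hB
  have hB0 : 0 < B := by positivity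
  have hlarge : ∀ r, r₀ + B / k ≤ r → c' / 2 * φ r ^ 2 ≤ φ' r := by
    intro r hr
    have hr0 : r₀ ≤ r := by
      have : 0 < B / k := by positivity
      linarith
    have h1 : B ≤ φ r ^ (e + 1) := by
      refine le_trans ?_ (hgrow r hr0)
      have : k * (B / k) ≤ k * (r - r₀) := mul_le_mul_of_nonneg_left (by linarith) hk0.le
      rwa [mul_div_cancel₀ _ hk0.ne'] at this
    have hB1 : 1 ≤ B := by
      have : 0 ≤ 2 * |W₀| / c' := by positivity
      linarith
    have h2 : 1 ≤ φ r := by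
      by_contra hlt
      have := Real.rpow_lt_one (h.pos r).le (not_le.1 hlt) (by linarith : 0 < e + 1)
      linarith
    have h3 : B ≤ φ r ^ (e + 2) := by
      rw [show e + 2 = (e + 1) + 1 by ring, Real.rpow_add_one (h.pos r).ne']
      nlinarith [hpp (e + 1) r]
    have h4 : |W₀| ≤ c' / 2 * φ r ^ (e + 2) := by
      have h5 : c' / 2 * (2 * |W₀| / c') = |W₀| := by field_simp
      have h6 : c' / 2 * B ≤ c' / 2 * φ r ^ (e + 2) := mul_le_mul_of_nonneg_left h3 (by positivity)
      rw [hB, mul_add, h5] at h6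
      linarith
    have h7 := hW0 r hr0
    have h8 : φ r ^ e * (c' / 2 * φ r ^ 2) ≤ φ r ^ e * φ' r := by
      have := neg_abs_le W₀
      rw [hadd2] at h4 h7
      linarith
    exact le_of_mul_le_mul_left h8 (hpp e r)
  refine false_of_hasDerivAt_le (f := fun r => (φ r)⁻¹) (f' := fun r => -φ' r / φ r ^ 2)
    (m := c' / 2) (r₁ := r₀ + B / k) (fun r => (h.hasDerivAt r).fun_inv (h.pos r).ne')
    (fun r => (inv_pos.2 (h.pos r)).le) (by positivity) fun r hr => ?_
  rw [div_le_iff₀ (pow_pos (h.pos r) 2)]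
  linarith [hlarge r hr]

theorem deriv_nonneg (h : IsWarpingSolution d c S φ φ' φ'') (hc : 0 < c) (hS : 0 ≤ S) (r : ℝ) :
    0 ≤ φ' r := by
  by_contra! hlt
  exact h.comp_neg.false_of_pos hc hS (r₀ := -r) (by simpa using hlt)

theorem deriv_eq_zero (h : IsWarpingSolution d c 0 φ φ' φ'') (hc : 0 < c) (r : ℝ) : φ' r = 0 := by
  by_contra hne
  have hnn := h.deriv_nonneg hc le_rfl
  have hpos : 0 < φ' r := lt_of_le_of_ne (hnn r) (Ne.symm hne)
  have hd := h.one_le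
  -- `φ` is concave and positive on the whole line
  have hconc : ∀ s, φ'' s ≤ 0 := fun s => by
    have h1 := h.ode s
    have h2 : 0 ≤ d * (d - 1) * φ' s ^ 2 :=
      mul_nonneg (mul_nonneg (by linarith) (by linarith)) (sq_nonneg _)
    have h3 : 0 ≤ c * φ' s * φ s ^ 2 := mul_nonneg (mul_nonneg hc.le (hnn s)) (sq_nonneg _)
    have h4 := h.pos s
    by_contra! hlt
    have : 0 < 2 * d * φ s * φ'' s := by positivity
    linarith
  refine false_of_le_hasDerivAt h.hasDerivAt (fun s => (h.pos s).le) hpos (r₁ := r) fun s hs => ?_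
  have := add_mul_le_of_le_hasDerivAt (f := fun r => -φ' r) (fun r => (h.hasDerivAt' r).neg)
    (m := 0) (fun r _ => by linarith [hconc r]) hs
  simpa using this

theorem not_pos (h : IsWarpingSolution d c S φ φ' φ'') (hc : 0 < c) : ¬ 0 < S := by
  intro hS
  have hnn := h.deriv_nonneg hc hS.le
  have hd := h.one_le
  have hφ0 := h.pos 0
  have hdd : 0 ≤ d * (d - 1) := mul_nonneg (by linarith) (by linarith)
  -- below the level `μ` of `φ'` the constant term dominates the equation
  obtain ⟨μ, hμ0, hμ1, hμ⟩ : ∃ μ : ℝ, 0 < μ ∧ μ ≤ 1 ∧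
      μ * (d * (d - 1) + c * φ 0 ^ 2) ≤ S / 2 := by
    have hK : 0 < d * (d - 1) + c * φ 0 ^ 2 := by positivity
    refine ⟨min 1 (S / 2 / (d * (d - 1) + c * φ 0 ^ 2)), by positivity, min_le_left _ _, ?_⟩
    rw [← le_div_iff₀ hK]
    exact min_le_right _ _
  have hmono : ∀ r, r ≤ 0 → φ r ≤ φ 0 := fun r hr => by
    simpa using add_mul_le_of_le_hasDerivAt h.hasDerivAt (m := 0) (fun r _ => hnn r) hr
  have hbound : ∀ r, r ≤ 0 → φ' r ≤ μ → S / 2 ≤ 2 * d * φ r * φ'' r := fun r hr hv => by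
    rw [h.ode]
    have h1 : φ r ^ 2 ≤ φ 0 ^ 2 := pow_le_pow_left₀ (h.pos r).le (hmono r hr) 2
    have h2 : φ' r ^ 2 ≤ μ := by nlinarith [hnn r]
    have h3 : d * (d - 1) * φ' r ^ 2 ≤ d * (d - 1) * μ := mul_le_mul_of_nonneg_left h2 hdd
    have h4 : c * φ' r * φ r ^ 2 ≤ c * μ * φ 0 ^ 2 :=
      mul_le_mul (mul_le_mul_of_nonneg_left hv hc.le) h1 (sq_nonneg _) (by positivity)
    linarith
  obtain ⟨r₀, hr₀, hv₀⟩ : ∃ r₀ ≤ 0, φ' r₀ ≤ μ := by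
    by_contra! hall
    exact false_of_le_hasDerivAt h.hasDerivAt (fun s => (h.pos s).le) hμ0 (r₁ := 0)
      fun s hs => (hall s hs).le
  have hstay : ∀ r, r ≤ r₀ → φ' r ≤ μ := fun r hr => by
    have := le_of_barrier_left (f := fun r => -φ' r) (fun r => (h.hasDerivAt' r).neg) (m := -μ)
      (r₁ := r₀) (by linarith) (fun r hr hm => by
        have h1 := hbound r (by linarith) (by linarith)
        have h2 : 0 < 2 * d * φ r := by have := h.pos r; positivity
        have h3 : 0 < φ'' r := (mul_pos_iff_of_pos_left h2).1 (by linarith)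
        linarith) hr
    linarith
  refine false_of_le_hasDerivAt h.hasDerivAt' hnn (m := S / 2 / (2 * d * φ 0)) (r₁ := r₀)
    (by positivity) fun r hr => ?_
  have h1 := hbound r (by linarith) (hstay r hr)
  have h2 : 0 < 2 * d * φ r := by have := h.pos r; positivity
  have h3 : 0 < φ'' r := (mul_pos_iff_of_pos_left h2).1 (by linarith)
  rw [div_le_iff₀ (by positivity)]
  refine h1.trans ?_
  have h4 : 2 * d * φ r ≤ 2 * d * φ 0 := mul_le_mul_of_nonneg_left (hmono r (by linarith))
    (by linarith)
  nlinarith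

theorem not_neg (h : IsWarpingSolution d c S φ φ' φ'') (hc : 0 < c) : ¬ S < 0 := by
  intro hS
  have hd := h.one_le
  have hdd : 0 ≤ d * (d - 1) := mul_nonneg (by linarith) (by linarith)
  have hsign : ∀ r, S - d * (d - 1) * φ' r ^ 2 - c * φ' r * φ r ^ 2 < 0 → φ'' r < 0 :=
    fun r hr => by
      rw [← h.ode] at hr
      have h2 : 0 < 2 * d * φ r := by have := h.pos r; positivity
      by_contra! h3
      linarith [mul_nonneg h2.le h3]
  have hconc : ∀ r, 0 ≤ φ' r → φ'' r < 0 := fun r hr => hsign r (by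
    have h1 : 0 ≤ d * (d - 1) * φ' r ^ 2 := by positivity
    have h2 : 0 ≤ c * φ' r * φ r ^ 2 := by positivity
    linarith)
  by_cases hex : ∃ r₀, 0 ≤ φ' r₀
  · -- to the left of `r₀` the function is increasing and concave
    obtain ⟨r₀, hr₀⟩ := hex
    have hnn : ∀ r, r ≤ r₀ → 0 ≤ φ' r := fun r hr =>
      le_of_barrier_left h.hasDerivAt' hr₀ (fun r _ hm => hconc r hm.ge) hr
    have hanti : StrictAntiOn φ' (Set.Iic r₀) := by
      refine strictAntiOn_of_hasDerivWithinAt_neg (f' := φ'') (convex_Iic r₀)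
        (fun x _ => (h.hasDerivAt' x).continuousAt.continuousWithinAt)
        (fun x _ => (h.hasDerivAt' x).hasDerivWithinAt) fun x hx => hconc x (hnn x ?_)
      exact Set.mem_Iic.1 (interior_subset (s := Set.Iic r₀) hx)
    have h1 : 0 < φ' (r₀ - 1) :=
      hr₀.trans_lt (hanti (Set.mem_Iic.2 (by linarith)) (Set.mem_Iic.2 le_rfl) (by linarith))
    refine false_of_le_hasDerivAt h.hasDerivAt (fun s => (h.pos s).le) h1 (r₁ := r₀ - 1)
      fun s hs => ?_
    exact hanti.antitoneOn (Set.mem_Iic.2 (by linarith)) (Set.mem_Iic.2 (by linarith)) hs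
  · push Not at hex
    have hφ0 := h.pos 0
    have hmono : ∀ r, 0 ≤ r → φ r ≤ φ 0 := fun r hr => by
      simpa using add_mul_le_of_le_hasDerivAt (f := fun r => -φ r)
        (fun r => (h.hasDerivAt r).neg) (m := 0) (fun r _ => by linarith [hex r]) hr
    -- a slope at which the constant term dominates acts as a barrier
    obtain ⟨μ, hμ0, hμ⟩ : ∃ μ : ℝ, 0 < μ ∧ c * μ * φ 0 ^ 2 = -S / 2 :=
      ⟨-S / 2 / (c * φ 0 ^ 2), div_pos (by linarith) (by positivity), by field_simp⟩
    obtain ⟨r₀, hr₀, hv₀⟩ : ∃ r₀ ≥ 0, -μ < φ' r₀ := by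
      by_contra! hall
      exact false_of_hasDerivAt_le h.hasDerivAt (fun s => (h.pos s).le) hμ0 (r₁ := 0)
        fun s hs => hall s hs
    refine false_of_hasDerivAt_le h.hasDerivAt (fun s => (h.pos s).le) (m := -φ' r₀)
      (by linarith [hex r₀]) (r₁ := r₀) fun r hr => ?_
    have := le_of_barrier (f := fun r => -φ' r) (fun r => (h.hasDerivAt' r).neg)
      (le_refl (-φ' r₀)) (fun r hr hm => neg_pos.2 (hsign r (by
        have h1 : 0 ≤ d * (d - 1) * φ' r ^ 2 := by positivity
        have h2 : φ r ^ 2 ≤ φ 0 ^ 2 := pow_le_pow_left₀ (h.pos r).le (hmono r (by linarith)) 2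
        have h3 : c * -φ' r * φ r ^ 2 ≤ c * μ * φ 0 ^ 2 :=
          mul_le_mul (mul_le_mul_of_nonneg_left (by linarith) hc.le) h2 (sq_nonneg _)
            (by positivity)
        linarith))) hr
    linarith

theorem deriv_eq_zero_of_pos (h : IsWarpingSolution d c S φ φ' φ'') (hc : 0 < c) (r : ℝ) :
    φ' r = 0 := by
  obtain rfl : S = 0 := le_antisymm (not_lt.1 (h.not_pos hc)) (not_lt.1 (h.not_neg hc))
  exact h.deriv_eq_zero hc r

/-- Positive solutions on the whole line are constant. -/
theorem deriv_eq_zero_of_ne (h : IsWarpingSolution d c S φ φ' φ'') (hc : c ≠ 0) (r : ℝ) :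
    φ' r = 0 := by
  rcases hc.lt_or_gt with hc | hc
  · simpa using h.comp_neg.deriv_eq_zero_of_pos (by linarith) (-r)
  · exact h.deriv_eq_zero_of_pos hc r

end IsWarpingSolution

end ODE

/-! ### Charts -/

section Charts

variable {E : Type*} [NormedAddCommGroup E] [NormedSpace ℝ E] [FiniteDimensional ℝ E]
  {H : Type*} [TopologicalSpace H] {I : ModelWithCorners ℝ E H} [I.Boundaryless]
  {M : Type*} [TopologicalSpace M] [ChartedSpace H M] [IsManifold I ∞ M]

omit [FiniteDimensional ℝ E] in
theorem contMDiffAt_symm (x₀ : M) {y : E} (hy : y ∈ (extChartAt I x₀).target) :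
    ContMDiffAt 𝓘(ℝ, E) I ∞ (extChartAt I x₀).symm y :=
  (contMDiffOn_extChartAt_symm x₀).contMDiffAt ((isOpen_extChartAt_target x₀).mem_nhds hy)

omit [FiniteDimensional ℝ E] in
theorem mdifferentiableAt_symm (x₀ : M) {y : E} (hy : y ∈ (extChartAt I x₀).target) :
    MDifferentiableAt 𝓘(ℝ, E) I (extChartAt I x₀).symm y :=
  (contMDiffAt_symm x₀ hy).mdifferentiableAt (by simp)

omit [FiniteDimensional ℝ E] [I.Boundaryless] in
theorem mdifferentiableAt_chart (x₀ : M) {x : M} (hx : x ∈ (extChartAt I x₀).source) :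
    MDifferentiableAt I 𝓘(ℝ, E) (extChartAt I x₀) x :=
  (contMDiffAt_extChartAt' (n := ∞) (by simpa using hx)).mdifferentiableAt (by simp)

omit [FiniteDimensional ℝ E] in
theorem mfderiv_chart_mfderiv_symm (x₀ : M) {y : E} (hy : y ∈ (extChartAt I x₀).target) (u : E) :
    mfderiv I 𝓘(ℝ, E) (extChartAt I x₀) ((extChartAt I x₀).symm y)
      (mfderiv 𝓘(ℝ, E) I (extChartAt I x₀).symm y u) = u := by
  have h1 := mfderiv_comp y (mdifferentiableAt_chart (I := I) x₀ ((extChartAt I x₀).map_target hy))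
    (mdifferentiableAt_symm x₀ hy)
  have h2 : extChartAt I x₀ ∘ (extChartAt I x₀).symm =ᶠ[𝓝 y] id :=
    Filter.eventually_of_mem ((isOpen_extChartAt_target x₀).mem_nhds hy) fun z hz =>
      (extChartAt I x₀).right_inv hz
  rw [h2.mfderiv_eq, mfderiv_id] at h1
  exact (congrArg (fun L : E →L[ℝ] E => L u) h1).symm

omit [FiniteDimensional ℝ E] in
theorem mfderiv_symm_mfderiv_chart (x₀ : M) {x : M} (hx : x ∈ (extChartAt I x₀).source)
    (u : TangentSpace I x) :
    mfderiv 𝓘(ℝ, E) I (extChartAt I x₀).symm (extChartAt I x₀ x)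
      (mfderiv I 𝓘(ℝ, E) (extChartAt I x₀) x u) = u := by
  have h1 := mfderiv_comp x (mdifferentiableAt_symm (I := I) x₀ ((extChartAt I x₀).map_source hx))
    (mdifferentiableAt_chart x₀ hx)
  have h2 : (extChartAt I x₀).symm ∘ extChartAt I x₀ =ᶠ[𝓝 x] id :=
    Filter.eventually_of_mem ((isOpen_extChartAt_source x₀).mem_nhds hx) fun z hz =>
      (extChartAt I x₀).left_inv hz
  rw [h2.mfderiv_eq, mfderiv_id] at h1
  exact (congrArg (fun L : E →L[ℝ] E => L u) h1).symm

omit [FiniteDimensional ℝ E] [I.Boundaryless] in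
theorem metricInChart_apply (g : Metric I M) (x₀ : M) (y u v : E) :
    metricInChart g x₀ y u v = g.inner ((extChartAt I x₀).symm y)
      (mfderiv 𝓘(ℝ, E) I (extChartAt I x₀).symm y u)
      (mfderiv 𝓘(ℝ, E) I (extChartAt I x₀).symm y v) := rfl

omit [FiniteDimensional ℝ E] in
theorem inner_eq_metricInChart (g : Metric I M) (x₀ : M) {x : M}
    (hx : x ∈ (extChartAt I x₀).source) (u v : TangentSpace I x) :
    g.inner x u v = metricInChart g x₀ (extChartAt I x₀ x)
      (mfderiv I 𝓘(ℝ, E) (extChartAt I x₀) x u) (mfderiv I 𝓘(ℝ, E) (extChartAt I x₀) x v) := by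
  have hinner : ∀ x' : M, x' = x → ∀ a b : E,
      (g.inner x : E →L[ℝ] E →L[ℝ] ℝ) a b = (g.inner x' : E →L[ℝ] E →L[ℝ] ℝ) a b := by
    rintro x' rfl a b; rfl
  refine (hinner _ ((extChartAt I x₀).left_inv hx) u v).trans ?_
  have h1 := mfderiv_symm_mfderiv_chart (I := I) x₀ hx u
  have h2 := mfderiv_symm_mfderiv_chart (I := I) x₀ hx v
  exact congrArg₂ (fun a b => (g.inner ((extChartAt I x₀).symm (extChartAt I x₀ x)) :
    E →L[ℝ] E →L[ℝ] ℝ) a b) h1.symm h2.symm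

open scoped Bundle in
theorem contDiffAt_metricInChart (g : Metric I M) (x₀ : M) {y : E}
    (hy : y ∈ (extChartAt I x₀).target) : ContDiffAt ℝ ∞ (metricInChart g x₀) y := by
  have : IsManifold I ((∞ : WithTop ℕ∞) + 1) M := ‹IsManifold I ∞ M›
  set T := (extChartAt I x₀).target
  have hT : IsOpen T := isOpen_extChartAt_target x₀
  have hsec : ∀ u : E, ContMDiffOn 𝓘(ℝ, E) I.tangent ∞
      (fun z => (⟨(extChartAt I x₀).symm z,
        mfderiv 𝓘(ℝ, E) I (extChartAt I x₀).symm z u⟩ : TangentBundle I M)) T := by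
    intro u
    have h1 : ContMDiffOn 𝓘(ℝ, E).tangent I.tangent ∞
        (tangentMapWithin 𝓘(ℝ, E) I (extChartAt I x₀).symm T) (Bundle.TotalSpace.proj ⁻¹' T) :=
      (contMDiffOn_extChartAt_symm x₀).contMDiffOn_tangentMapWithin (m := ∞) le_rfl
        hT.uniqueMDiffOn
    have h2 : ContMDiff 𝓘(ℝ, E) 𝓘(ℝ, E).tangent ∞
        (fun z : E => (⟨z, u⟩ : TangentBundle 𝓘(ℝ, E) E)) :=
      contMDiff_vectorSpace_iff_contDiff.2 contDiff_const
    refine (h1.comp h2.contMDiffOn (fun z hz => hz)).congr fun z hz => ?_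
    simp only [Function.comp_apply, tangentMapWithin, mfderivWithin_of_isOpen hT hz]
  have hon : ContDiffOn ℝ ∞ (metricInChart g x₀) T := by
    refine contDiffOn_clm_apply.2 fun u => contDiffOn_clm_apply.2 fun v => ?_
    let _ : Bundle.RiemannianBundle (fun x : M => TangentSpace I x) := ⟨g.toRiemannianMetric⟩
    exact contMDiffOn_iff_contDiffOn.1 (ContMDiffOn.inner_bundle (IB := I)
      (E := fun x : M => TangentSpace I x) (b := (extChartAt I x₀).symm)
      (v := fun z => mfderiv 𝓘(ℝ, E) I (extChartAt I x₀).symm z u)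
      (w := fun z => mfderiv 𝓘(ℝ, E) I (extChartAt I x₀).symm z v) (hsec u) (hsec v))
  exact hon.contDiffAt (hT.mem_nhds hy)

/-- The expression of a metric in a chart is a metric on the image of the chart. -/
theorem isMetricOn_metricInChart (g : Metric I M) (x₀ : M) :
    IsMetricOn (metricInChart g x₀) (extChartAt I x₀).target where
  isOpen := isOpen_extChartAt_target x₀
  contDiffAt _ hy := contDiffAt_metricInChart g x₀ hy
  symm y _ u v := by rw [metricInChart_apply, g.symm, metricInChart_apply]
  pos y hy u hu := by
    rw [metricInChart_apply]
    refine g.pos _ _ fun h0 => hu ?_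
    rw [← mfderiv_chart_mfderiv_symm (I := I) x₀ hy u, h0]
    exact map_zero _

/-- The coordinate image of the intersection of two chart domains. -/
def overlap (I : ModelWithCorners ℝ E H) (x₀ x₁ : M) : Set E :=
  (extChartAt I x₀).target ∩ (extChartAt I x₀).symm ⁻¹' (extChartAt I x₁).source

omit [FiniteDimensional ℝ E] in
theorem isOpen_overlap (x₀ x₁ : M) : IsOpen (overlap I x₀ x₁) :=
  (contMDiffOn_extChartAt_symm (n := ∞) x₀).continuousOn.isOpen_inter_preimage
    (isOpen_extChartAt_target x₀) (isOpen_extChartAt_source x₁)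

theorem isPullbackOn_transition (g : Metric I M) (x₀ x₁ : M) :
    IsPullbackOn (metricInChart g x₀) (overlap I x₀ x₁) (metricInChart g x₁)
      (extChartAt I x₁).target (extChartAt I x₁ ∘ (extChartAt I x₀).symm) where
  source :=
    { isOpen := isOpen_overlap x₀ x₁
      contDiffAt := fun y hy => (isMetricOn_metricInChart g x₀).contDiffAt y hy.1
      symm := fun y hy => (isMetricOn_metricInChart g x₀).symm y hy.1
      pos := fun y hy => (isMetricOn_metricInChart g x₀).pos y hy.1 }
  target := isMetricOn_metricInChart g x₁
  mapsTo _ hy := (extChartAt I x₁).map_source hy.2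
  contDiffAt y hy := by
    refine contMDiffAt_iff_contDiffAt.1 ?_
    exact (contMDiffAt_extChartAt' (n := ∞) (by simpa using hy.2)).comp y (contMDiffAt_symm x₀ hy.1)
  eq y hy u v := by
    have h1 := mfderiv_comp y (mdifferentiableAt_chart (I := I) x₁ hy.2)
      (mdifferentiableAt_symm x₀ hy.1)
    rw [mfderiv_eq_fderiv] at h1
    rw [metricInChart_apply, inner_eq_metricInChart g x₁ hy.2, h1]
    rfl

/-- The scalar curvature may be computed in any chart. -/
theorem localScalar_metricInChart (g : Metric I M) (x₀ : M) {y : E}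
    (hy : y ∈ (extChartAt I x₀).target) :
    localScalar (metricInChart g x₀) y = scalarCurvature g ((extChartAt I x₀).symm y) :=
  (isPullbackOn_transition g x₀ ((extChartAt I x₀).symm y)).localScalar_eq
    ⟨hy, mem_extChartAt_source _⟩

omit [FiniteDimensional ℝ E] in
theorem contDiffAt_comp_symm {f : M → ℝ} (hf : ContMDiff I 𝓘(ℝ, ℝ) ∞ f) (x₀ : M) {y : E}
    (hy : y ∈ (extChartAt I x₀).target) : ContDiffAt ℝ ∞ (f ∘ (extChartAt I x₀).symm) y :=
  contMDiffAt_iff_contDiffAt.1 ((hf _).comp y (contMDiffAt_symm x₀ hy))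

omit [FiniteDimensional ℝ E] in
theorem localHessian_congr (G : E → E →L[ℝ] E →L[ℝ] ℝ) {F F' : E → ℝ} {y : E} (h : F =ᶠ[𝓝 y] F')
    (u v : E) : localHessian G F y u v = localHessian G F' y u v := by
  rw [localHessian, localHessian, h.fderiv.fderiv_eq, h.fderiv_eq]

/-- The Hessian may be computed in any chart. -/
theorem localHessian_metricInChart (g : Metric I M) {f : M → ℝ} (hf : ContMDiff I 𝓘(ℝ, ℝ) ∞ f)
    (x₀ : M) {y : E} (hy : y ∈ (extChartAt I x₀).target) (u v : E) :
    localHessian (metricInChart g x₀) (f ∘ (extChartAt I x₀).symm) y u v =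
      hessian g f ((extChartAt I x₀).symm y) (mfderiv 𝓘(ℝ, E) I (extChartAt I x₀).symm y u)
        (mfderiv 𝓘(ℝ, E) I (extChartAt I x₀).symm y v) := by
  set x₁ := (extChartAt I x₀).symm y with hx₁
  have hyo : y ∈ overlap I x₀ x₁ := ⟨hy, mem_extChartAt_source _⟩
  have h1 : f ∘ (extChartAt I x₀).symm =ᶠ[𝓝 y]
      (f ∘ (extChartAt I x₁).symm) ∘ (extChartAt I x₁ ∘ (extChartAt I x₀).symm) :=
    Filter.eventually_of_mem ((isOpen_overlap x₀ x₁).mem_nhds hyo) fun z hz =>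
      congrArg f ((extChartAt I x₁).left_inv hz.2).symm
  have h2 := mfderiv_comp y (mdifferentiableAt_chart (I := I) x₁ hyo.2)
    (mdifferentiableAt_symm x₀ hy)
  rw [mfderiv_eq_fderiv] at h2
  rw [localHessian_congr _ h1, (isPullbackOn_transition g x₀ x₁).localHessian_eq hyo
    (isOpen_extChartAt_target x₁) (mem_extChartAt_target x₁)
    (fun z hz => contDiffAt_comp_symm hf x₁ hz), h2]
  rfl

omit [FiniteDimensional ℝ E] in
/-- A smooth function on a connected manifold whose derivative vanishes, at each point in the chart
at that point, is constant. -/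
theorem eq_of_fderiv_eq_zero [PreconnectedSpace M] {f : M → ℝ} (hf : ContMDiff I 𝓘(ℝ, ℝ) ∞ f)
    (h : ∀ x : M, fderiv ℝ (f ∘ (extChartAt I x).symm) (extChartAt I x x) = 0) (x x' : M) :
    f x = f x' := by
  have hm : ∀ x, mfderiv I 𝓘(ℝ, ℝ) f x = 0 := by
    intro x
    have h1 : f =ᶠ[𝓝 x] (f ∘ (extChartAt I x).symm) ∘ extChartAt I x :=
      Filter.eventually_of_mem ((isOpen_extChartAt_source (I := I) x).mem_nhds
        (mem_extChartAt_source x)) fun z hz => congrArg f ((extChartAt I x).left_inv hz).symm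
    rw [h1.mfderiv_eq, mfderiv_comp x (contDiffAt_comp_symm hf x
      (mem_extChartAt_target x)).differentiableAt_infty.mdifferentiableAt
      (mdifferentiableAt_chart x (mem_extChartAt_source x)), mfderiv_eq_fderiv, h]
    exact ContinuousLinearMap.zero_comp _
  have hloc : IsLocallyConstant f := by
    rw [IsLocallyConstant.iff_eventually_eq]
    intro x
    obtain ⟨ε, hε, hball⟩ := _root_.Metric.isOpen_iff.1 (isOpen_extChartAt_target (I := I) x) _
      (mem_extChartAt_target x)
    have hc := (continuousAt_extChartAt (I := I) x).eventually_mem (_root_.Metric.ball_mem_nhds _ hε)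
    filter_upwards [hc, (isOpen_extChartAt_source (I := I) x).mem_nhds (mem_extChartAt_source x)]
      with z hz hzs
    have h2 := _root_.Metric.isOpen_ball.is_const_of_fderiv_eq_zero (𝕜 := ℝ)
      (f := f ∘ (extChartAt I x).symm) (convex_ball _ _).isPreconnected
      (fun y hy => (contDiffAt_comp_symm hf x
        (hball hy)).differentiableAt_infty.differentiableWithinAt)
      (fun y hy => by
        have h3 := mfderiv_comp y ((hf _).mdifferentiableAt (by simp))
          (mdifferentiableAt_symm (I := I) x (hball hy))
        rw [mfderiv_eq_fderiv, hm] at h3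
        exact h3.trans (ContinuousLinearMap.zero_comp _)) hz (_root_.Metric.mem_ball_self hε)
    have h3 : f ((extChartAt I x).symm (extChartAt I x z)) =
        f ((extChartAt I x).symm (extChartAt I x x)) := h2
    rwa [(extChartAt I x).left_inv hzs, (extChartAt I x).left_inv (mem_extChartAt_source x)] at h3
  exact hloc.apply_eq_of_isPreconnected isPreconnected_univ trivial trivial

end Charts

/-! ### The Hessian of a function on a warped product -/

section WarpedHessian

variable {E : Type*} [NormedAddCommGroup E] [NormedSpace ℝ E]

theorem differentiableAt_smul_fst_snd {K : Type*} [NormedAddCommGroup K] [NormedSpace ℝ K]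
    {p : ℝ → ℝ} {q : E → K} {x : ℝ × E} (hp : DifferentiableAt ℝ p x.1)
    (hq : DifferentiableAt ℝ q x.2) : DifferentiableAt ℝ (fun x : ℝ × E => p x.1 • q x.2) x :=
  (hp.comp x differentiableAt_fst).smul (hq.comp x differentiableAt_snd)

variable [FiniteDimensional ℝ E]
  {Gw : ℝ × E → (ℝ × E) →L[ℝ] (ℝ × E) →L[ℝ] ℝ} {φ : ℝ → ℝ} {G : E → E →L[ℝ] E →L[ℝ] ℝ}
  {U : Set E}

namespace IsWarpedOn

variable (h : IsWarpedOn Gw φ G U) {y : E} (hy : y ∈ U)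

include h hy

/-- If the Hessian of `F` has no mixed terms, the derivative of `F` along the fibre is proportional
to the warping function. -/
theorem fderiv_fibre {F : ℝ × E → ℝ} (hF : ∀ s, ContDiffAt ℝ ∞ F (s, y)) {v : E}
    (hess : ∀ s, localHessian Gw F (s, y) (1, 0) (0, v) = 0) (s : ℝ) :
    fderiv ℝ F (s, y) (0, v) = φ s / φ 0 * fderiv ℝ F (0, y) (0, v) := by
  have hφ (s : ℝ) := (h.pos s).ne'
  have hD : ∀ s, HasDerivAt (fun s => fderiv ℝ F (s, y) (0, v))
      (deriv φ s / φ s * fderiv ℝ F (s, y) (0, v)) s := fun s => by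
    have h1 : HasDerivAt (fun s : ℝ => (s, y)) ((1 : ℝ), (0 : E)) s :=
      (hasDerivAt_id s).prodMk (hasDerivAt_const s y)
    have h2 := (((hF s).fderiv_infty.differentiableAt_infty).hasFDerivAt.comp_hasDerivAt s h1)
    have h3 := h2.clm_apply (hasDerivAt_const s ((0 : ℝ), v))
    refine h3.congr_deriv ?_
    have h4 := hess s
    have h5 : christoffel Gw (s, y) (1, 0) (0, v) = (deriv φ s / φ s) • ((0 : ℝ), v) := by
      rw [h.christoffel_eq (x := (s, y)) hy]; simp
    rw [localHessian, h5, map_smul, smul_eq_mul] at h4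
    simp only [map_zero, add_zero]
    linarith
  have hk : ∀ s, HasDerivAt (fun s => fderiv ℝ F (s, y) (0, v) / φ s) 0 s := fun s => by
    refine ((hD s).fun_div (h.hasDerivAt s) (hφ s)).congr_deriv ?_
    have := hφ s
    field_simp
    ring
  have hc := is_const_of_deriv_eq_zero (fun s => (hk s).differentiableAt)
    (fun s => (hk s).deriv) s 0
  rw [div_eq_div_iff (hφ s) (hφ 0)] at hc
  have := hφ 0
  field_simp
  linarith

theorem localHessian_separated {W : E → ℝ} {u : ℝ → ℝ} (hW : ∀ y ∈ U, ContDiffAt ℝ ∞ W y)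
    (hu : ContDiff ℝ ∞ u) (s : ℝ) (a b : ℝ × E) :
    localHessian Gw (fun x => φ x.1 * W x.2 + u x.1) (s, y) a b =
      a.1 * b.1 * (deriv (deriv φ) s * W y + deriv (deriv u) s)
        + φ s * localHessian G W y a.2 b.2
        + φ s * deriv φ s * (deriv φ s * W y + deriv u s) * G y a.2 b.2 := by
  have hφ := (h.pos s).ne'
  have hdφ := h.contDiff.hasDerivAt_infty
  have hddφ := h.contDiff.deriv_infty.hasDerivAt_infty
  have hdu := hu.hasDerivAt_infty
  have hddu := hu.deriv_infty.hasDerivAt_infty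
  set F : ℝ × E → ℝ := fun x => φ x.1 * W x.2 + u x.1
  have hu2 : ∀ {u : ℝ → ℝ} {x : ℝ × E}, DifferentiableAt ℝ u x.1 → ∀ z,
      fderiv ℝ (fun x : ℝ × E => u x.1) x z = z.1 * deriv u x.1 := fun {u x} hu z => by
    have h1 : HasFDerivAt (fun x : ℝ × E => u x.1) _ x := hu.hasFDerivAt.comp x hasFDerivAt_fst
    rw [h1.fderiv]
    simp
  have hd1 : ∀ x : ℝ × E, x.2 ∈ U → ContDiffAt ℝ ∞ F x := fun x hx =>
    ((h.contDiff.contDiffAt.comp x contDiffAt_fst).mul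
      ((hW x.2 hx).comp x contDiffAt_snd)).add (hu.contDiffAt.comp x contDiffAt_fst)
  have hF1 : ∀ x : ℝ × E, x.2 ∈ U → ∀ z, fderiv ℝ F x z =
      z.1 * (deriv φ x.1 * W x.2 + deriv u x.1) + φ x.1 * fderiv ℝ W x.2 z.2 := fun x hx z => by
    have hWd := (hW x.2 hx).differentiableAt_infty
    have h1 : DifferentiableAt ℝ (fun x : ℝ × E => φ x.1 • W x.2) x :=
      differentiableAt_smul_fst_snd (hdφ x.1).differentiableAt hWd
    have h2 : DifferentiableAt ℝ (fun x : ℝ × E => u x.1) x :=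
      (hdu x.1).differentiableAt.comp x differentiableAt_fst
    change fderiv ℝ (fun x : ℝ × E => φ x.1 • W x.2 + u x.1) x z = _
    rw [fderiv_fun_add h1 h2, add_apply, fderiv_smul_fst_snd (hdφ x.1).differentiableAt hWd,
      hu2 (hdu x.1).differentiableAt]
    simp only [smul_eq_mul]
    ring
  have hF2 : fderiv ℝ (fderiv ℝ F) (s, y) a b =
      b.1 * (a.1 * deriv (deriv φ) s * W y + deriv φ s * fderiv ℝ W y a.2
        + a.1 * deriv (deriv u) s)
      + (a.1 * deriv φ s * fderiv ℝ W y b.2 + φ s * fderiv ℝ (fderiv ℝ W) y a.2 b.2) := by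
    have h1 := fderiv_clm_apply_apply (hd1 (s, y) hy).fderiv_infty.differentiableAt_infty
      (differentiableAt_const b) a
    have h2 : (fun x => fderiv ℝ F x b) =ᶠ[𝓝 (s, y)] fun x =>
        (b.1 • (deriv φ x.1 • W x.2 + deriv u x.1) + φ x.1 • fderiv ℝ W x.2 b.2) :=
      Filter.eventually_of_mem (h.total.mem_nhds (y := (s, y)) ⟨trivial, hy⟩)
        fun x hx => hF1 x hx.2 b
    have hWd := (hW y hy).differentiableAt_infty
    have hWdd : DifferentiableAt ℝ (fun y => fderiv ℝ W y b.2) y :=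
      (hW y hy).fderiv_infty.differentiableAt_infty.clm_apply (differentiableAt_const _)
    have h3 : DifferentiableAt ℝ (fun x : ℝ × E => deriv φ x.1 • W x.2) (s, y) :=
      differentiableAt_smul_fst_snd (hddφ s).differentiableAt hWd
    have h4 : DifferentiableAt ℝ (fun x : ℝ × E => deriv u x.1) (s, y) :=
      DifferentiableAt.comp (g := deriv u) (s, y) (hddu s).differentiableAt differentiableAt_fst
    have h5 : DifferentiableAt ℝ (fun x : ℝ × E => φ x.1 • fderiv ℝ W x.2 b.2) (s, y) :=
      differentiableAt_smul_fst_snd (q := fun y => fderiv ℝ W y b.2) (hdφ s).differentiableAt hWdd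
    have h6 := fderiv_clm_apply_apply (hW y hy).fderiv_infty.differentiableAt_infty
      (differentiableAt_const b.2) a.2
    rw [h2.fderiv_eq, fderiv_fun_add ((h3.fun_add h4).fun_const_smul b.1) h5,
      fderiv_fun_const_smul (h3.fun_add h4), fderiv_fun_add h3 h4, add_apply, smul_apply, add_apply,
      fderiv_smul_fst_snd (hddφ s).differentiableAt hWd, hu2 (hddu s).differentiableAt,
      fderiv_smul_fst_snd (p := φ) (q := fun y => fderiv ℝ W y b.2)
        (hdφ s).differentiableAt hWdd, h6] at h1
    simp only [fderiv_fun_const, Pi.zero_apply, zero_apply, map_zero, add_zero, smul_eq_mul] at h1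
    rw [← h1]
  rw [localHessian, hF2, hF1 (s, y) hy, h.christoffel_eq (x := (s, y)) hy, localHessian]
  simp only [map_add, map_smul, smul_eq_mul]
  field_simp
  ring

end IsWarpedOn

end WarpedHessian

/-! ### Solitons on a warped product -/

section Product

variable {E : Type*} [NormedAddCommGroup E] [NormedSpace ℝ E] [FiniteDimensional ℝ E]
  {H : Type*} [TopologicalSpace H] {I : ModelWithCorners ℝ E H} [I.Boundaryless]
  {M : Type*} [TopologicalSpace M] [ChartedSpace H M] [IsManifold I ∞ M]
  {N : Type*} [TopologicalSpace N] [ChartedSpace H N] [IsManifold I ∞ N]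

omit [FiniteDimensional ℝ E] [I.Boundaryless] in
theorem exists_mfderiv_chart_eq (x : M) (a : E) :
    ∃ u : TangentSpace I x, mfderiv I 𝓘(ℝ, E) (extChartAt I x) x u = a := by
  have : IsManifold I 1 M := IsManifold.of_le (n := ∞) (by simp)
  obtain ⟨e, he⟩ := isInvertible_mfderiv_extChartAt (I := I) (mem_extChartAt_source (I := I) x)
  exact ⟨e.symm a, by rw [← he]; exact e.apply_symm_apply a⟩

omit [FiniteDimensional ℝ E] in
theorem localHessian_eq_of_hessian_eq {g : Metric I M} {f : M → ℝ} {x : M} {k : ℝ}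
    (hk : ∀ u v, hessian g f x u v = k * g.inner x u v) (a b : E) :
    localHessian (metricInChart g x) (f ∘ (extChartAt I x).symm) (extChartAt I x x) a b =
      k * metricInChart g x (extChartAt I x x) a b := by
  obtain ⟨u, rfl⟩ := exists_mfderiv_chart_eq (I := I) x a
  obtain ⟨v, rfl⟩ := exists_mfderiv_chart_eq (I := I) x b
  have := hk u v
  rw [inner_eq_metricInChart g x (mem_extChartAt_source x)] at this
  exact this

omit [FiniteDimensional ℝ E] [I.Boundaryless] [IsManifold I ∞ N] in
theorem extChartAt_real_prod (r : ℝ) (p : N) :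
    extChartAt (𝓘(ℝ, ℝ).prod I) (r, p) = (PartialEquiv.refl ℝ).prod (extChartAt I p) := by
  rw [extChartAt_prod, extChartAt_model_space_eq_id]

/-- In product charts a warped product metric is a warped product. -/
theorem isWarpedOn_metricInChart {g : Metric (𝓘(ℝ, ℝ).prod I) (ℝ × N)} {φ : ℝ → ℝ}
    {h : Metric I N} (hφ : ContDiff ℝ ∞ φ) (hφpos : ∀ r, 0 < φ r) (hg : IsWarpedProduct g φ h)
    (r : ℝ) (p : N) :
    IsWarpedOn (metricInChart g (r, p)) φ (metricInChart h p) (extChartAt I p).target where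
  total := by
    have := isMetricOn_metricInChart g (r, p)
    rwa [extChartAt_real_prod] at this
  base := isMetricOn_metricInChart h p
  contDiff := hφ
  pos := hφpos
  eq x hx a b := by
    have hx' : x ∈ (extChartAt (𝓘(ℝ, ℝ).prod I) (r, p)).target := by
      rw [extChartAt_real_prod]; exact ⟨trivial, hx⟩
    have hs : ∀ z, (extChartAt (𝓘(ℝ, ℝ).prod I) (r, p)).symm z =
        (z.1, (extChartAt I p).symm z.2) := fun z => by
      rw [extChartAt_real_prod]; rfl
    have hd := mdifferentiableAt_symm (I := 𝓘(ℝ, ℝ).prod I) (r, p) hx'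
    have h1 : ∀ a, mfderiv (𝓘(ℝ, ℝ).prod I) 𝓘(ℝ, ℝ) Prod.fst
        ((extChartAt (𝓘(ℝ, ℝ).prod I) (r, p)).symm x)
        (mfderiv 𝓘(ℝ, ℝ × E) (𝓘(ℝ, ℝ).prod I) (extChartAt (𝓘(ℝ, ℝ).prod I) (r, p)).symm x a) =
        a.1 := fun a => by
      have h2 := mfderiv_comp x (mdifferentiableAt_fst (I := 𝓘(ℝ, ℝ)) (I' := I)) hd
      have h3 : (Prod.fst ∘ (extChartAt (𝓘(ℝ, ℝ).prod I) (r, p)).symm : ℝ × E → ℝ) = Prod.fst :=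
        funext fun z => by rw [Function.comp_apply, hs]
      rw [h3, mfderiv_eq_fderiv, fderiv_fst] at h2
      exact (congrArg (fun L : ℝ × E →L[ℝ] ℝ => L a) h2).symm
    have h4 : ∀ a, mfderiv (𝓘(ℝ, ℝ).prod I) I Prod.snd
        ((extChartAt (𝓘(ℝ, ℝ).prod I) (r, p)).symm x)
        (mfderiv 𝓘(ℝ, ℝ × E) (𝓘(ℝ, ℝ).prod I) (extChartAt (𝓘(ℝ, ℝ).prod I) (r, p)).symm x a) =
        mfderiv 𝓘(ℝ, E) I (extChartAt I p).symm x.2 a.2 := fun a => by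
      have h2 := mfderiv_comp x (mdifferentiableAt_snd (I := 𝓘(ℝ, ℝ)) (I' := I)) hd
      have h3 : (Prod.snd ∘ (extChartAt (𝓘(ℝ, ℝ).prod I) (r, p)).symm : ℝ × E → N) =
          (extChartAt I p).symm ∘ Prod.snd :=
        funext fun z => by rw [Function.comp_apply, hs]; rfl
      have h5 := mfderiv_comp x (mdifferentiableAt_symm (I := I) p hx)
        (differentiableAt_snd (𝕜 := ℝ) (p := x)).mdifferentiableAt
      rw [mfderiv_eq_fderiv, fderiv_snd] at h5
      rw [h3, h5] at h2
      exact (congrArg (fun L : ℝ × E →L[ℝ] E => L a) h2).symm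
    rw [metricInChart_apply, metricInChart_apply]
    refine (hg _ _ _).trans ?_
    have hp : ((extChartAt (𝓘(ℝ, ℝ).prod I) (r, p)).symm x).2 = (extChartAt I p).symm x.2 := by
      rw [hs]
    have hinner : ∀ q q' : N, q = q' → ∀ a b : E,
        (h.inner q : E →L[ℝ] E →L[ℝ] ℝ) a b = (h.inner q' : E →L[ℝ] E →L[ℝ] ℝ) a b := by
      rintro q _ rfl a b; rfl
    refine congrArg₂ (· + ·) (congrArg₂ (· * ·) (h1 a) (h1 b)) (congrArg₂ (· * ·) (by rw [hs]) ?_)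
    exact (hinner _ _ hp _ _).trans (congrArg₂ (fun a b : E =>
      (h.inner ((extChartAt I p).symm x.2) : E →L[ℝ] E →L[ℝ] ℝ) a b) (h4 a) (h4 b))

end Product

/-! ### Reduction to the warping function -/

section Reduction

variable {E : Type*} [NormedAddCommGroup E] [NormedSpace ℝ E] [FiniteDimensional ℝ E]
  {H : Type*} [TopologicalSpace H] {I : ModelWithCorners ℝ E H} [I.Boundaryless]
  {N : Type*} [TopologicalSpace N] [ChartedSpace H N] [IsManifold I ∞ N]
  {g : Metric (𝓘(ℝ, ℝ).prod I) (ℝ × N)} {φ : ℝ → ℝ} {h : Metric I N} {f : ℝ × N → ℝ}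

omit [FiniteDimensional ℝ E] [I.Boundaryless] in
theorem exists_inner_ne_zero [Nontrivial E] (h : Metric I N) (p : N) :
    ∃ v : TangentSpace I p, h.inner p v v ≠ 0 := by
  obtain ⟨v, hv⟩ := exists_ne (0 : E)
  exact ⟨v, (h.pos p v hv).ne'⟩

/-- On a warped product with connected fibre, a function whose Hessian is a multiple of the metric
is `φ(r) w(p) + u(r)`. -/
theorem exists_separated [ConnectedSpace N] (hφ : ContDiff ℝ ∞ φ) (hφpos : ∀ r, 0 < φ r)
    (hg : IsWarpedProduct g φ h) (hf : ContMDiff (𝓘(ℝ, ℝ).prod I) 𝓘(ℝ, ℝ) ∞ f) {k : ℝ × N → ℝ}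
    (hess : ∀ x u v, hessian g f x u v = k x * g.inner x u v) :
    ∃ (w : N → ℝ) (u : ℝ → ℝ), ContMDiff I 𝓘(ℝ, ℝ) ∞ w ∧ ContDiff ℝ ∞ u ∧
      ∀ x, f x = φ x.1 * w x.2 + u x.1 := by
  have hslice : ∀ s, ContMDiff I 𝓘(ℝ, ℝ) ∞ fun p => f (s, p) := fun s =>
    hf.comp (contMDiff_const.prodMk contMDiff_id)
  have hline : ∀ p, ContDiff ℝ ∞ fun s => f (s, p) := fun p =>
    contMDiff_iff_contDiff.1 (hf.comp (contMDiff_id.prodMk contMDiff_const))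
  have hconst : ∀ s p q, f (s, p) - φ s / φ 0 * f (0, p) = f (s, q) - φ s / φ 0 * f (0, q) := by
    intro s p q
    refine eq_of_fderiv_eq_zero (I := I) (f := fun p => f (s, p) - φ s / φ 0 * f (0, p))
      ((hslice s).sub (contMDiff_const.mul (hslice 0))) (fun p => ?_) p q
    set y := extChartAt I p p with hy
    have hyt : y ∈ (extChartAt I p).target := mem_extChartAt_target p
    have hW := isWarpedOn_metricInChart hφ hφpos hg 0 p
    set F : ℝ × E → ℝ := f ∘ (extChartAt (𝓘(ℝ, ℝ).prod I) ((0 : ℝ), p)).symm with hF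
    have hFr : ∀ r, f ∘ (extChartAt (𝓘(ℝ, ℝ).prod I) (r, p)).symm = F := fun r => by
      rw [hF, extChartAt_real_prod, extChartAt_real_prod]
    have hGr : ∀ r, metricInChart g (r, p) = metricInChart g (0, p) := fun r => by
      funext x
      simp only [metricInChart]
      rw [extChartAt_real_prod, extChartAt_real_prod]
    have hsmooth : ∀ s, ContDiffAt ℝ ∞ F (s, y) := fun s => by
      refine contDiffAt_comp_symm hf _ ?_
      rw [extChartAt_real_prod]
      exact ⟨trivial, hyt⟩
    have hx : ∀ r, extChartAt (𝓘(ℝ, ℝ).prod I) (r, p) (r, p) = (r, y) := fun r => by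
      rw [extChartAt_real_prod]; rfl
    have hmix : ∀ v s, localHessian (metricInChart g (0, p)) F (s, y) (1, 0) (0, v) = 0 := by
      intro v s
      have h1 := localHessian_eq_of_hessian_eq (hess (s, p)) (1, 0) (0, v)
      rw [hFr, hGr, hx, hW.eq (s, y) hyt] at h1
      rw [h1]
      simp
    have hFs : ∀ s, HasFDerivAt ((fun p => f (s, p)) ∘ (extChartAt I p).symm)
        ((fderiv ℝ F (s, y)).comp (ContinuousLinearMap.inr ℝ ℝ E)) y := fun s => by
      have h1 : HasFDerivAt (fun z : E => (s, z)) (ContinuousLinearMap.inr ℝ ℝ E) y :=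
        hasFDerivAt_prodMk_right s y
      have h2 := (hsmooth s).differentiableAt_infty.hasFDerivAt.comp y h1
      have h3 : F ∘ (fun z : E => (s, z)) = (fun p => f (s, p)) ∘ (extChartAt I p).symm := by
        funext z
        rw [hF, extChartAt_real_prod]
        rfl
      rwa [h3] at h2
    have h4 := ((hFs s).sub ((hFs 0).const_mul (φ s / φ 0))).fderiv
    refine h4.trans ?_
    ext v
    have h5 := hW.fderiv_fibre hyt hsmooth (hmix v) s
    simp [h5]
  obtain ⟨p₀⟩ := (inferInstance : Nonempty N)
  refine ⟨fun p => f (0, p) / φ 0, fun s => f (s, p₀) - φ s / φ 0 * f (0, p₀),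
    (hslice 0).div_const _, (hline p₀).sub ((hφ.div_const _).mul contDiff_const), fun x => ?_⟩
  have := hconst x.1 x.2 p₀
  simp only
  rw [← this]
  ring

/-- The equation `Hess f = R g` for `f = φ(r) w(p) + u(r)`: the radial part, and the part along the
fibre. -/
theorem separated_equations (hφ : ContDiff ℝ ∞ φ) (hφpos : ∀ r, 0 < φ r)
    (hg : IsWarpedProduct g φ h)
    (hess : ∀ x u v, hessian g f x u v = scalarCurvature g x * g.inner x u v)
    {w : N → ℝ} {u : ℝ → ℝ} (hw : ContMDiff I 𝓘(ℝ, ℝ) ∞ w) (hu : ContDiff ℝ ∞ u)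
    (hfw : ∀ x, f x = φ x.1 * w x.2 + u x.1) (r : ℝ) (p : N) :
    deriv (deriv φ) r * w p + deriv (deriv u) r =
        scalarCurvature h p / φ r ^ 2
          - 2 * Module.finrank ℝ E * (deriv (deriv φ) r / φ r)
          - Module.finrank ℝ E * (Module.finrank ℝ E - 1) * (deriv φ r / φ r) ^ 2 ∧
      ∀ a b, hessian h w p a b =
        ((φ r * deriv (deriv φ) r - deriv φ r ^ 2) * w p
          + (φ r * deriv (deriv u) r - deriv φ r * deriv u r)) * h.inner p a b := by
  have hφr := (hφpos r).ne'
  set y := extChartAt I p p with hy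
  have hyt : y ∈ (extChartAt I p).target := mem_extChartAt_target p
  have hW := isWarpedOn_metricInChart hφ hφpos hg r p
  have hF : f ∘ (extChartAt (𝓘(ℝ, ℝ).prod I) (r, p)).symm =
      fun x => φ x.1 * (w ∘ (extChartAt I p).symm) x.2 + u x.1 := by
    funext x
    rw [extChartAt_real_prod, Function.comp_apply, hfw]
    rfl
  have hx : extChartAt (𝓘(ℝ, ℝ).prod I) (r, p) (r, p) = (r, y) := by
    rw [extChartAt_real_prod]; rfl
  have hwy : (w ∘ (extChartAt I p).symm) y = w p := by
    rw [Function.comp_apply, hy, extChartAt_to_inv]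
  have hR : scalarCurvature g (r, p) = scalarCurvature h p / φ r ^ 2
      - 2 * Module.finrank ℝ E * (deriv (deriv φ) r / φ r)
      - Module.finrank ℝ E * (Module.finrank ℝ E - 1) * (deriv φ r / φ r) ^ 2 := by
    rw [scalarCurvature, hx, hW.localScalar_eq (x := (r, y)) hyt]
    rfl
  have key : ∀ a b, _ := fun a b => localHessian_eq_of_hessian_eq (hess (r, p)) a b
  simp only [hx, hF, hW.eq (r, y) hyt, hW.localHessian_separated hyt
    (fun z hz => contDiffAt_comp_symm hw p hz) hu, hwy] at key
  have hrad : deriv (deriv φ) r * w p + deriv (deriv u) r = scalarCurvature g (r, p) := by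
    have := key (1, 0) (1, 0)
    simpa [localHessian] using this
  refine ⟨hrad.trans hR, fun a b => ?_⟩
  have hfib := key (0, mfderiv I 𝓘(ℝ, E) (extChartAt I p) p a)
    (0, mfderiv I 𝓘(ℝ, E) (extChartAt I p) p b)
  rw [← hrad] at hfib
  rw [inner_eq_metricInChart h p (mem_extChartAt_source p)]
  change localHessian (metricInChart h p) (w ∘ (extChartAt I p).symm) y _ _ = _ * _
  simp only [zero_mul, zero_add] at hfib
  refine mul_left_cancel₀ hφr ?_
  linear_combination hfib

/-- A function on a manifold of constant scalar curvature `S` with Hessian `b h`, where `b` is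
constant, exists only for `b S = 0`. -/
theorem mul_scalarCurvature_eq_zero {w : N → ℝ} (hw : ContMDiff I 𝓘(ℝ, ℝ) ∞ w) {b S : ℝ}
    (hess : ∀ p u v, hessian h w p u v = b * h.inner p u v) (hS : ∀ p, scalarCurvature h p = S)
    (p : N) : b * S = 0 :=
  (isMetricOn_metricInChart h p).mul_localScalar_eq_zero (W := w ∘ (extChartAt I p).symm)
    (fun y hy => contDiffAt_comp_symm hw p hy)
    (fun y hy u v => by
      rw [localHessian_metricInChart h hw p hy, hess, metricInChart_apply])
    (fun y hy => by rw [localScalar_metricInChart h p hy, hS])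
    ⟨_, mem_extChartAt_target p⟩

/-- A positive function on `ℝ` with `φ'' φ²` and `φ φ'' - φ'²` constant is constant. -/
theorem deriv_eq_zero_of_const (hφ : ContDiff ℝ ∞ φ) (hφpos : ∀ r, 0 < φ r) {e κ : ℝ}
    (he : ∀ r, deriv (deriv φ) r * φ r ^ 2 = e)
    (hκ : ∀ r, φ r * deriv (deriv φ) r - deriv φ r ^ 2 = κ) (r : ℝ) : deriv φ r = 0 := by
  have h1 := hφ.hasDerivAt_infty
  have h2 := hφ.deriv_infty.hasDerivAt_infty
  have h0 (r : ℝ) := (hφpos r).ne'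
  -- differentiating `e / φ - φ'² = κ` gives `φ' φ'' = 0`
  have hprod : ∀ r, deriv φ r * deriv (deriv φ) r = 0 := by
    intro r
    have h3 : HasDerivAt (fun r => e / φ r - deriv φ r ^ 2)
        (-(e * deriv φ r) / φ r ^ 2 - 2 * deriv φ r * deriv (deriv φ) r) r := by
      refine (((hasDerivAt_const r e).fun_div (h1 r) (h0 r)).fun_sub
        ((h2 r).fun_pow 2)).congr_deriv ?_
      simp
    have h4 : (fun r => e / φ r - deriv φ r ^ 2) = fun _ => κ := by
      funext s
      rw [← hκ s, ← he s]
      have := h0 s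
      field_simp
    rw [h4] at h3
    have h5 := h3.unique (hasDerivAt_const r κ)
    rw [← he r] at h5
    have := h0 r
    field_simp at h5
    linarith
  have hsq : ∀ s, deriv φ s ^ 2 = deriv φ r ^ 2 := fun s =>
    is_const_of_deriv_eq_zero (f := fun s => deriv φ s ^ 2)
      (fun s => ((h2 s).fun_pow 2).differentiableAt)
      (fun s => by rw [((h2 s).fun_pow 2).deriv]; simpa using hprod s) s r
  by_contra hne
  have hne' : ∀ s, deriv φ s ≠ 0 := fun s h => hne (by simpa [h] using (hsq s).symm)
  have hc : ∀ s, deriv φ s = deriv φ r := fun s =>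
    is_const_of_deriv_eq_zero (f := deriv φ) (fun s => (h2 s).differentiableAt)
      (fun s => (mul_eq_zero.1 (hprod s)).resolve_left (hne' s)) s r
  rcases lt_or_gt_of_ne hne with hlt | hgt
  · exact false_of_hasDerivAt_le h1 (fun r => (hφpos r).le) (neg_pos.2 hlt) (r₁ := 0)
      fun s _ => by rw [hc s, neg_neg]
  · exact false_of_le_hasDerivAt h1 (fun r => (hφpos r).le) hgt (r₁ := 0)
      fun s _ => (hc s).ge

theorem eq_of_deriv_eq_zero (hφ : ContDiff ℝ ∞ φ) (h : ∀ r, deriv φ r = 0) (r : ℝ) : φ r = φ 0 :=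
  is_const_of_deriv_eq_zero (hφ.differentiable (by simp)) h r 0

/-- The warping function of a nontrivial steady soliton is constant, and the fibre is scalar
flat. -/
theorem warping_const_and_scalar_flat [Nontrivial E] [ConnectedSpace N] (hφ : ContDiff ℝ ∞ φ)
    (hφpos : ∀ r, 0 < φ r) (hg : IsWarpedProduct g φ h)
    (hf : ContMDiff (𝓘(ℝ, ℝ).prod I) 𝓘(ℝ, ℝ) ∞ f) (hne : ¬ ∃ c : ℝ, ∀ x, f x = c)
    (hess : ∀ x u v, hessian g f x u v = scalarCurvature g x * g.inner x u v) :
    (∀ r, φ r = φ 0) ∧ ∀ p, scalarCurvature h p = 0 := by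
  obtain ⟨w, u, hw, hu, hfw⟩ := exists_separated hφ hφpos hg hf hess
  have hφ0 (r : ℝ) := (hφpos r).ne'
  have heq := fun r p => (separated_equations hφ hφpos hg hess hw hu hfw r p).1
  have hhess := fun r p => (separated_equations hφ hφpos hg hess hw hu hfw r p).2
  by_cases hconst : ∀ p q, w p = w q
  · obtain ⟨p₀⟩ := (inferInstance : Nonempty N)
    -- `f` depends on `r` only, and its derivative is proportional to `φ`
    set v : ℝ → ℝ := fun r => φ r * w p₀ + u r with hv
    have hfv : ∀ x, f x = v x.1 := fun x => by rw [hfw, hconst x.2 p₀]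
    have hvs : ContDiff ℝ ∞ v := (hφ.mul contDiff_const).add hu
    have hv1 : deriv v = fun r => deriv φ r * w p₀ + deriv u r := funext fun r =>
      (((hφ.hasDerivAt_infty r).mul_const (w p₀)).fun_add (hu.hasDerivAt_infty r)).deriv
    have hv2 : ∀ r, deriv (deriv v) r = deriv (deriv φ) r * w p₀ + deriv (deriv u) r := fun r => by
      rw [hv1]
      exact (((hφ.deriv_infty.hasDerivAt_infty r).mul_const (w p₀)).fun_add
        (hu.deriv_infty.hasDerivAt_infty r)).deriv
    have hzero : ∀ r, φ r * deriv (deriv v) r = deriv φ r * deriv v r := by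
      intro r
      obtain ⟨a, ha⟩ := exists_inner_ne_zero h p₀
      have h1 := hhess r p₀ a a
      have h2 : hessian h w p₀ a a = 0 := by
        have : w = fun _ => w p₀ := funext fun q => hconst q p₀
        rw [hessian, this]
        simp [localHessian, Function.comp_def]
        rfl
      rw [h2] at h1
      have h3 := (mul_eq_zero.1 h1.symm).resolve_right ha
      rw [hv2, hv1]
      linear_combination h3
    obtain ⟨c, hc⟩ : ∃ c, ∀ r, deriv v r = c * φ r := by
      refine ⟨deriv v 0 / φ 0, fun r => ?_⟩
      have h1 : ∀ r, HasDerivAt (fun r => deriv v r / φ r) 0 r := fun r => by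
        refine ((hvs.deriv_infty.hasDerivAt_infty r).fun_div (hφ.hasDerivAt_infty r)
          (hφ0 r)).congr_deriv ?_
        rw [div_eq_zero_iff]
        left
        linear_combination hzero r
      have h2 := is_const_of_deriv_eq_zero (fun r => (h1 r).differentiableAt)
        (fun r => (h1 r).deriv) r 0
      rw [← h2, div_mul_cancel₀ _ (hφ0 r)]
    have hc0 : c ≠ 0 := by
      rintro rfl
      refine hne ⟨v 0, fun x => ?_⟩
      rw [hfv]
      exact eq_of_deriv_eq_zero hvs (fun r => by simp [hc]) x.1
    have hv3 : ∀ r, deriv (deriv v) r = c * deriv φ r := fun r => by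
      rw [show deriv v = fun r => c * φ r from funext hc]
      exact ((hφ.hasDerivAt_infty r).const_mul c).deriv
    have hsol : ∀ p, IsWarpingSolution (Module.finrank ℝ E) c (scalarCurvature h p) φ (deriv φ)
        (deriv (deriv φ)) := fun p =>
      { one_le := by exact_mod_cast Module.finrank_pos
        hasDerivAt := hφ.hasDerivAt_infty
        hasDerivAt' := hφ.deriv_infty.hasDerivAt_infty
        pos := hφpos
        ode := fun r => by
          have h1 := heq r p
          rw [hconst p p₀, ← hv2, hv3] at h1
          have := hφ0 r
          field_simp at h1
          linear_combination h1 }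
    have hd := fun p => (hsol p).deriv_eq_zero_of_ne hc0
    refine ⟨eq_of_deriv_eq_zero hφ (hd p₀), fun p => ?_⟩
    have h1 := (hsol p).ode 0
    have h2 : deriv (deriv φ) 0 = 0 := by
      rw [show deriv φ = fun _ => 0 from funext (hd p₀), deriv_const]
    rw [h2, hd p₀] at h1
    linarith
  · push Not at hconst
    obtain ⟨p, q, hpq⟩ := hconst
    have hpq' : w p - w q ≠ 0 := sub_ne_zero.2 hpq
    have hd : ∀ r, deriv φ r = 0 := by
      refine deriv_eq_zero_of_const hφ hφpos
        (e := (scalarCurvature h p - scalarCurvature h q) / (w p - w q))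
        (κ := φ 0 * deriv (deriv φ) 0 - deriv φ 0 ^ 2) (fun r => ?_) (fun r => ?_)
      · rw [eq_div_iff hpq']
        have h1 := heq r p
        have h2 := heq r q
        have h3 : deriv (deriv φ) r * (w p - w q) =
            (scalarCurvature h p - scalarCurvature h q) / φ r ^ 2 := by
          rw [sub_div]
          linear_combination h1 - h2
        rw [eq_div_iff (pow_ne_zero 2 (hφ0 r))] at h3
        linear_combination h3
      · have hindep : ∀ p, (φ r * deriv (deriv φ) r - deriv φ r ^ 2) * w p
            + (φ r * deriv (deriv u) r - deriv φ r * deriv u r) =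
            (φ 0 * deriv (deriv φ) 0 - deriv φ 0 ^ 2) * w p
            + (φ 0 * deriv (deriv u) 0 - deriv φ 0 * deriv u 0) := fun p => by
          obtain ⟨a, ha⟩ := exists_inner_ne_zero h p
          exact mul_right_cancel₀ ha ((hhess r p a a).symm.trans (hhess 0 p a a))
        refine mul_right_cancel₀ hpq' ?_
        linear_combination hindep p - hindep q
    have hdd : deriv (deriv φ) 0 = 0 := by
      rw [show deriv φ = fun _ => 0 from funext hd, deriv_const]
    -- now `u'' = R` is constant, `w` has Hessian `φ u'' h`, and `N` has scalar curvature `φ² u''`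
    have hS : ∀ p, scalarCurvature h p = φ 0 ^ 2 * deriv (deriv u) 0 := fun p => by
      have h1 := heq 0 p
      rw [hdd, hd 0] at h1
      have := hφ0 0
      field_simp at h1
      linarith
    have h1 := mul_scalarCurvature_eq_zero (h := h) hw (b := φ 0 * deriv (deriv u) 0)
      (fun p a b => by rw [hhess 0 p a b, hdd, hd 0]; ring) hS p
    refine ⟨eq_of_deriv_eq_zero hφ hd, fun p => ?_⟩
    have h2 : deriv (deriv u) 0 = 0 := by
      have := hφ0 0
      simpa [this] using h1
    rw [hS, h2, mul_zero]

/-- The metric `c² h`. -/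
def scaledMetric (h : Metric I N) {c : ℝ} (hc : 0 < c) : Metric I N where
  inner p := c ^ 2 • h.inner p
  symm p u v := by simp [h.symm p u v]
  pos p u hu := by
    have := h.pos p u hu
    simp
    positivity
  isVonNBounded p := by
    refine ((h.isVonNBounded p).image (c⁻¹ • ContinuousLinearMap.id ℝ (TangentSpace I p))).subset ?_
    intro u hu
    refine ⟨c • u, ?_, ?_⟩
    · simp only [Set.mem_ofPred_eq, smul_apply, smul_eq_mul] at hu
      simp only [Set.mem_ofPred_eq, map_smul, smul_apply, smul_eq_mul]
      linarith
    · simp [smul_smul, hc.ne']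
  contMDiff := h.contMDiff.const_smul_section

end Reduction

end YamabeSoliton

end

theorem theorem1p1 {d : ℕ} (hd : 1 ≤ d)
    {N : Type*} [TopologicalSpace N] [ChartedSpace (EuclideanSpace ℝ (Fin d)) N]
    [IsManifold (𝓡 d) ∞ N] [T2Space N] [SecondCountableTopology N] [ConnectedSpace N]
    (h : YamabeSoliton.Metric (𝓡 d) N)
    (φ : ℝ → ℝ) (hφ : ContDiff ℝ ∞ φ) (hφpos : ∀ r, 0 < φ r)
    (g : YamabeSoliton.Metric (𝓘(ℝ, ℝ).prod (𝓡 d)) (ℝ × N))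
    (hg : YamabeSoliton.IsWarpedProduct g φ h)
    (f : ℝ × N → ℝ) (hf : ¬ ∃ c : ℝ, ∀ x, f x = c)
    (hsol : YamabeSoliton.IsCompleteGradientYamabeSoliton g f 0) :
    ∃ c : ℝ, 0 < c ∧ (∀ r, φ r = c) ∧ (∀ p, YamabeSoliton.scalarCurvature h p = 0) ∧
      ∃ k : YamabeSoliton.Metric (𝓡 d) N,
        (∀ (p : N) (u v : TangentSpace (𝓡 d) p), k.inner p u v = c ^ 2 * h.inner p u v) ∧
        YamabeSoliton.IsRiemannianProduct g k := by
  have : Nonempty (Fin d) := ⟨⟨0, hd⟩⟩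
  obtain ⟨hφc, hS⟩ := YamabeSoliton.warping_const_and_scalar_flat hφ hφpos hg hsol.smooth hf
    (fun x u v => by rw [hsol.hess_eq, sub_zero])
  refine ⟨φ 0, hφpos 0, hφc, hS, YamabeSoliton.scaledMetric h (hφpos 0), fun p u v => rfl,
    fun x u v => ?_⟩
  refine (hg x u v).trans ?_
  rw [hφc x.1]
  simp [YamabeSoliton.scaledMetric]
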